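/- Let $0<m\le n$ be integers. Let $G_h(2n,m)$ be the set of $m$-dimensional linear subspaces $V\subset\mathbb{R}^{2n}$ on which the standard symplectic form $\omega((x,y),(u,v))=x\cdot v-y\cdot u$ vanishes, with the topology of the metric $\|P_V-P_W\|$, where $P_V$ is the orthogonal projection onto $V$. Let $\mu_{2n,m}$ be the $U(n)$-invariant Borel probability measure on $G_h(2n,m)$, that is, the image of the normalized Haar measure of $U(n)$ under $g\mapsto gV_0$, with $V_0$ spanned by the first $m$ of the $x$-coordinate directions and $\mathbb{R}^{2n}=\mathbb{C}^n$ via $(x,y)\mapsto x+iy$. Let $\mathcal{H}^m$ be the $m$-dimensional Hausdorff measure. For a compactly supported Radon measure $\mu$ on $\mathbb{R}^{2n}$, $V\in G_h(2n,m)$ and $v\in V$, the sliced measure $\mu_{V^\perp+v}$ is the Radon measure that satisfies $$\int\varphi\,d\mu_{V^\perp+v}=\lim_{\delta\to0^+}(2\delta)^{-m}\int_{\{x:\,|P_V(x)-v|\le\delta\}}\varphi\,d\mu$$ for all continuous $\varphi\ge0$ with compact support, provided that all these limits exist and are finite (and we set $\mu_{V^\perp+v}=0$ otherwise). For a measure $\nu$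 on $\mathbb{R}^{2n}$ and $t\in\mathbb{R}$ let $I_t(\nu)=\iint|x-y|^{-t}\,d\nu(y)\,d\nu(x)\in[0,\infty]$, where $0^{-t}$ is $\infty$, $1$, $0$ for $t>0$, $t=0$, $t<0$ respectively. Then there is a finite constant $c=c(n,m)$ such that for all $s\in\mathbb{R}$ and all compactly supported Radon measures $\mu$ on $\mathbb{R}^{2n}$, $$\int_{G_h(2n,m)}\int_V I_{s-m}(\mu_{V^\perp+v})\,d\mathcal{H}^m(v)\,d\mu_{2n,m}(V)\le c\,I_s(\mu).$$ Here, for every $V\in G_h(2n,m)$, the limits that define $\mu_{V^\perp+v}$ exist and are finite for $\mathcal{H}^m$-almost every $v\in V$; the function $v\mapsto I_{s-m}(\mu_{V^\perp+v})$ is $\mathcal{H}^m$-measurable on $V$; and the function $V\mapsto\int_V I_{s-m}(\mu_{V^\perp+v})\,d\mathcal{H}^m(v)$ is $\mu_{2n,m}$-measurable on $G_h(2n,m)$. -/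

import Mathlib

open MeasureTheory Filter Topology Metric
open scoped NNReal ENNReal

noncomputable section

/-- The Euclidean space `ℝ^{2n}` of points `(x, y)`, with `x` the coordinates indexed by `Sum.inl`
and `y` those indexed by `Sum.inr`. -/
abbrev R2n (n : ℕ) : Type := EuclideanSpace ℝ (Fin n ⊕ Fin n)

/-- The standard symplectic form `ω((x, y), (u, v)) = x · v - y · u`. -/
def sympForm {n : ℕ} (p q : R2n n) : ℝ :=
  ∑ j, p (Sum.inl j) * q (Sum.inr j) - ∑ j, p (Sum.inr j) * q (Sum.inl j)

/-- The isotropic Grassmannian `G_h(2n, m)`: the `m`-dimensional linear subspaces of `ℝ^{2n}` on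
which the symplectic form vanishes. -/
@[ext]
structure IsoGrass (n m : ℕ) where
  /-- The underlying plane. -/
  plane : Submodule ℝ (R2n n)
  finrank_eq : Module.finrank ℝ plane = m
  isotropic : ∀ p ∈ plane, ∀ q ∈ plane, sympForm p q = 0

namespace IsoGrass

variable {n m : ℕ}

/-- The orthogonal projection `P_V : ℝ^{2n} → V ⊆ ℝ^{2n}`. -/
def proj (V : IsoGrass n m) : R2n n →L[ℝ] R2n n := V.plane.starProjection

/-- The usual topology of the Grassmannian: the one of the metric `‖P_V - P_W‖`. -/
instance : TopologicalSpace (IsoGrass n m) := TopologicalSpace.induced proj inferInstance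

instance : MeasurableSpace (IsoGrass n m) := borel _

instance : BorelSpace (IsoGrass n m) := ⟨rfl⟩

end IsoGrass

/-! ### The unitary group and its action on `ℝ^{2n} = ℂⁿ` -/

/-- The unitary group `U(n)`. -/
abbrev Un (n : ℕ) : Type := Matrix.unitaryGroup (Fin n) ℂ

instance (n : ℕ) : MeasurableSpace (Un n) := borel _

instance (n : ℕ) : BorelSpace (Un n) := ⟨rfl⟩

instance instCompactSpaceUn (n : ℕ) : CompactSpace (Un n) := by
  refine isCompact_iff_compactSpace.1 ?_
  let B : Set (Matrix (Fin n) (Fin n) ℂ) :=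
    Set.univ.pi fun _ : Fin n => Set.univ.pi fun _ : Fin n => closedBall (0 : ℂ) 1
  have hB : IsCompact B := isCompact_univ_pi fun _ => isCompact_univ_pi fun _ =>
    isCompact_closedBall _ _
  refine hB.of_isClosed_subset ?_ ?_
  · have h : ((Matrix.unitaryGroup (Fin n) ℂ : Submonoid _) : Set (Matrix (Fin n) (Fin n) ℂ))
        = {A | star A * A = 1} := by
      ext A; exact Matrix.mem_unitaryGroup_iff'
    rw [h]
    exact isClosed_eq (by fun_prop) continuous_const
  · intro A hA i _ j _
    simpa using entry_norm_bound_of_unitary hA i j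

/-- The real `2n × 2n` matrix by which the complex matrix `A` acts on `ℝ^{2n}`, when `(x, y)` is
read as `x + i y ∈ ℂⁿ`. -/
def realMatrix {n : ℕ} (A : Matrix (Fin n) (Fin n) ℂ) : Matrix (Fin n ⊕ Fin n) (Fin n ⊕ Fin n) ℝ :=
  Matrix.fromBlocks (A.map Complex.re) (-(A.map Complex.im)) (A.map Complex.im) (A.map Complex.re)

theorem realMatrix_one {n : ℕ} : realMatrix (1 : Matrix (Fin n) (Fin n) ℂ) = 1 := by
  ext (i | i) (j | j) <;> by_cases h : i = j <;> simp [realMatrix, Matrix.one_apply, h]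

theorem realMatrix_mul {n : ℕ} (A B : Matrix (Fin n) (Fin n) ℂ) :
    realMatrix (A * B) = realMatrix A * realMatrix B := by
  ext (i | i) (j | j) <;>
    simp [realMatrix, Matrix.mul_apply, Finset.sum_add_distrib, Finset.sum_sub_distrib] <;> ring

theorem realMatrix_star {n : ℕ} (A : Matrix (Fin n) (Fin n) ℂ) :
    realMatrix (star A) = star (realMatrix A) := by
  ext (i | i) (j | j) <;> simp [realMatrix, Matrix.star_apply]

/-- The action of `U(n)` on `ℝ^{2n} = ℂⁿ` by linear isometries. -/
def unAct (n : ℕ) : Un n →* (R2n n ≃ₗᵢ[ℝ] R2n n) :=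
  (Unitary.linearIsometryEquiv (𝕜 := ℝ) (H := R2n n)).toMonoidHom.comp
    { toFun := fun g => ⟨Matrix.toEuclideanCLM (𝕜 := ℝ) (realMatrix (g : Matrix _ _ ℂ)), by
        rw [Unitary.mem_iff, ← map_star, ← map_mul, ← map_mul, ← realMatrix_star,
          ← realMatrix_mul, ← realMatrix_mul, Matrix.mem_unitaryGroup_iff.1 g.2,
          Matrix.mem_unitaryGroup_iff'.1 g.2, realMatrix_one, map_one]
        exact ⟨rfl, rfl⟩⟩
      map_one' := by ext1; simp [realMatrix_one]
      map_mul' := fun g h => by ext1; simp [realMatrix_mul] }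

theorem unAct_apply {n : ℕ} (g : Un n) (p : R2n n) :
    unAct n g p = Matrix.toEuclideanCLM (𝕜 := ℝ) (realMatrix (g : Matrix _ _ ℂ)) p := rfl

/-- In complex coordinates the action is `z ↦ g z`. -/
theorem unAct_coord {n : ℕ} (g : Un n) (p : R2n n) (i : Fin n) :
    (⟨unAct n g p (Sum.inl i), unAct n g p (Sum.inr i)⟩ : ℂ) =
      ∑ j, (g : Matrix (Fin n) (Fin n) ℂ) i j * ⟨p (Sum.inl j), p (Sum.inr j)⟩ := by
  apply Complex.ext <;>
    simp [unAct_apply, Matrix.ofLp_toEuclideanCLM, realMatrix, Matrix.mulVec, dotProduct,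
      Finset.sum_add_distrib, Finset.sum_sub_distrib] <;> ring

theorem sympForm_eq_im {n : ℕ} (p q : R2n n) :
    sympForm p q = (∑ j, star (⟨p (Sum.inl j), p (Sum.inr j)⟩ : ℂ) *
      ⟨q (Sum.inl j), q (Sum.inr j)⟩).im := by
  simp [sympForm, Finset.sum_add_distrib]; ring

theorem sympForm_unAct {n : ℕ} (g : Un n) (p q : R2n n) :
    sympForm (unAct n g p) (unAct n g q) = sympForm p q := by
  have key : ∀ z w : Fin n → ℂ,
      star ((g : Matrix (Fin n) (Fin n) ℂ).mulVec z) ⬝ᵥ (g : Matrix _ _ ℂ).mulVec w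
        = star z ⬝ᵥ w := by
    intro z w
    rw [Matrix.star_mulVec, Matrix.dotProduct_mulVec, Matrix.vecMul_vecMul,
      ← Matrix.star_eq_conjTranspose, Unitary.coe_star_mul_self, Matrix.vecMul_one]
  rw [sympForm_eq_im, sympForm_eq_im]
  simp only [unAct_coord]
  exact congrArg Complex.im (key _ _)

namespace IsoGrass

variable {n m : ℕ}

/-- The image `gV` of an isotropic plane under a unitary map. -/
def act (g : Un n) (V : IsoGrass n m) : IsoGrass n m where
  plane := V.plane.map ((unAct n g).toLinearEquiv : R2n n →ₗ[ℝ] R2n n)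
  finrank_eq := (LinearEquiv.finrank_map_eq (unAct n g).toLinearEquiv V.plane).trans V.finrank_eq
  isotropic := by
    rintro _ ⟨p, hp, rfl⟩ _ ⟨q, hq, rfl⟩
    exact (sympForm_unAct g p q).trans (V.isotropic p hp q hq)

theorem act_mul (g h : Un n) (V : IsoGrass n m) : act (g * h) V = act g (act h V) := by
  ext1
  simp only [act, map_mul, ← Submodule.map_comp]
  rfl

theorem proj_act (g : Un n) (V : IsoGrass n m) :
    (act g V).proj = Matrix.toEuclideanCLM (𝕜 := ℝ) (realMatrix (g : Matrix _ _ ℂ)) * V.proj *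
      Matrix.toEuclideanCLM (𝕜 := ℝ) (realMatrix (star (g : Matrix _ _ ℂ))) := by
  ext1 x
  have h := Submodule.starProjection_map_apply (unAct n g) V.plane x
  have h2 : (unAct n g).symm x = unAct n g⁻¹ x := by rw [map_inv]; rfl
  rw [h2] at h
  exact h

theorem continuous_toCLM_realMatrix :
    Continuous fun A : Matrix (Fin n) (Fin n) ℂ =>
      Matrix.toEuclideanCLM (𝕜 := ℝ) (realMatrix A) := by
  have h1 : Continuous fun A : Matrix (Fin n ⊕ Fin n) (Fin n ⊕ Fin n) ℝ =>
      Matrix.toEuclideanCLM (𝕜 := ℝ) A :=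
    LinearMap.continuous_of_finiteDimensional
      (Matrix.toEuclideanCLM (𝕜 := ℝ) (n := Fin n ⊕ Fin n)).toAlgEquiv.toLinearMap
  refine h1.comp ?_
  unfold realMatrix
  refine Continuous.matrix_fromBlocks ?_ ?_ ?_ ?_
  · exact continuous_id.matrix_map Complex.continuous_re
  · exact (continuous_id.matrix_map Complex.continuous_im).neg
  · exact continuous_id.matrix_map Complex.continuous_im
  · exact continuous_id.matrix_map Complex.continuous_re

theorem continuous_proj : Continuous (proj : IsoGrass n m → _) := continuous_induced_dom

theorem continuous_act : Continuous fun q : Un n × IsoGrass n m => act q.1 q.2 := by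
  refine continuous_induced_rng.2 ?_
  simp only [Function.comp_def, proj_act]
  have h1 : Continuous fun q : Un n × IsoGrass n m => (q.1 : Matrix (Fin n) (Fin n) ℂ) :=
    continuous_subtype_val.comp continuous_fst
  exact ((continuous_toCLM_realMatrix.comp h1).mul (continuous_proj.comp continuous_snd)).mul
    (continuous_toCLM_realMatrix.comp h1.star)

/-- The coordinate plane spanned by the first `m` of the `x`-directions. -/
def base (h : m ≤ n) : IsoGrass n m where
  plane := Submodule.span ℝ
    (Set.range fun i : Fin m => EuclideanSpace.single (Sum.inl (Fin.castLE h i)) (1 : ℝ))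
  finrank_eq := by
    have h1 : LinearIndependent ℝ fun i : Fin m =>
        (EuclideanSpace.single (Sum.inl (Fin.castLE h i)) (1 : ℝ) : R2n n) :=
      (EuclideanSpace.orthonormal_single (𝕜 := ℝ) (ι := Fin n ⊕ Fin n)).linearIndependent.comp
        (fun i : Fin m => Sum.inl (Fin.castLE h i))
        (Sum.inl_injective.comp (Fin.castLE_injective h))
    rw [finrank_span_eq_card h1, Fintype.card_fin]
  isotropic := by
    have h0 : ∀ p ∈ Submodule.span ℝ
        (Set.range fun i : Fin m => (EuclideanSpace.single (Sum.inl (Fin.castLE h i)) (1 : ℝ) :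
          R2n n)), ∀ j, p (Sum.inr j) = 0 := by
      intro p hp j
      induction hp using Submodule.span_induction with
      | mem x hx => obtain ⟨i, rfl⟩ := hx; simp
      | zero => simp
      | add x y _ _ hx hy => simp [hx, hy]
      | smul a x _ hx => simp [hx]
    intro p hp q hq
    simp [sympForm, h0 p hp, h0 q hq]

/-- The measure `μ_{2n,m}` on `G_h(2n, m)`: the image of the normalized Haar measure of `U(n)` under
the orbit map `g ↦ g V₀`. -/
def unif (h : m ≤ n) : Measure (IsoGrass n m) :=
  (Measure.haarMeasure (⊤ : TopologicalSpace.PositiveCompacts (Un n))).map fun g => act g (base h)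

theorem measurable_orbit (V : IsoGrass n m) : Measurable fun g : Un n => act g V :=
  (continuous_act.comp (Continuous.prodMk_left V)).measurable

instance instIsProbabilityMeasureUnif (h : m ≤ n) : IsProbabilityMeasure (unif h) := by
  have : IsProbabilityMeasure
      (Measure.haarMeasure (⊤ : TopologicalSpace.PositiveCompacts (Un n))) :=
    ⟨by simpa using Measure.haarMeasure_self (K₀ := (⊤ : TopologicalSpace.PositiveCompacts (Un n)))⟩
  exact Measure.isProbabilityMeasure_map (measurable_orbit _).aemeasurable

/-- `μ_{2n,m}` is invariant under `U(n)`. -/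
theorem map_act_unif (h : m ≤ n) (g : Un n) : (unif h).map (act g) = unif h := by
  have hg : Measurable (act g : IsoGrass n m → _) :=
    (continuous_act.comp (Continuous.prodMk_right g)).measurable
  have hm : Measurable fun k : Un n => g * k := (continuous_const_mul g).measurable
  unfold unif
  rw [Measure.map_map hg (measurable_orbit _)]
  conv_rhs => rw [← map_mul_left_eq_self
    (Measure.haarMeasure (⊤ : TopologicalSpace.PositiveCompacts (Un n))) g]
  rw [Measure.map_map (measurable_orbit _) hm]
  congr 1
  funext k
  exact (act_mul g k _).symm

/-! ### Sliced measures -/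

/-- `(2δ)^{-m} (P_V)_# μ_φ (B(v, δ))`, where `μ_φ` is the measure with density `φ` with respect to
`μ` and `B(v, δ)` is the closed ball. -/
def sliceAverage (μ : Measure (R2n n)) (V : IsoGrass n m) (v : R2n n)
    (φ : CompactlySupportedContinuousMap (R2n n) ℝ≥0) (δ : ℝ) : ℝ≥0∞ :=
  (ENNReal.ofReal (2 * δ) ^ m)⁻¹ *
    ((μ.withDensity fun x => (φ x : ℝ≥0∞)).map V.proj) (closedBall v δ)

/-- The limit of the averages exists and is finite, for every continuous `φ ≥ 0` with compact
support. -/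
def HasSlice (μ : Measure (R2n n)) (V : IsoGrass n m) (v : R2n n) : Prop :=
  ∀ φ : CompactlySupportedContinuousMap (R2n n) ℝ≥0,
    ∃ L : ℝ≥0, Tendsto (sliceAverage μ V v φ) (𝓝[>] 0) (𝓝 (L : ℝ≥0∞))

theorem sliceAverage_eq (μ : Measure (R2n n)) (V : IsoGrass n m) (v : R2n n)
    (φ : CompactlySupportedContinuousMap (R2n n) ℝ≥0) (δ : ℝ) :
    sliceAverage μ V v φ δ = (ENNReal.ofReal (2 * δ) ^ m)⁻¹ *
      ∫⁻ x in V.proj ⁻¹' closedBall v δ, φ x ∂μ := by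
  have hm : Measurable V.proj := V.proj.continuous.measurable
  rw [sliceAverage, Measure.map_apply hm isClosed_closedBall.measurableSet,
    withDensity_apply _ (hm isClosed_closedBall.measurableSet)]

/-- The positive linear functional `φ ↦ lim_{δ → 0} (2δ)^{-m} (P_V)_# μ_φ (B(v, δ))`. -/
def sliceFunctional {μ : Measure (R2n n)} {V : IsoGrass n m} {v : R2n n} (h : HasSlice μ V v) :
    CompactlySupportedContinuousMap (R2n n) ℝ≥0 →ₗ[ℝ≥0] ℝ≥0 where
  toFun φ := (h φ).choose
  map_add' φ ψ := by
    have h1 := (h φ).choose_spec.add (h ψ).choose_spec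
    have h2 := (h (φ + ψ)).choose_spec
    have h3 : sliceAverage μ V v (φ + ψ) = fun δ => sliceAverage μ V v φ δ +
        sliceAverage μ V v ψ δ := by
      funext δ
      simp only [sliceAverage_eq, ← mul_add]
      rw [← lintegral_add_left (by have := φ.continuous; fun_prop)]
      simp
    have h4 := tendsto_nhds_unique (h2.congr fun δ => congrFun h3 δ) h1
    exact_mod_cast h4
  map_smul' a φ := by
    have h1 := ENNReal.Tendsto.const_mul (a := (a : ℝ≥0∞)) (h φ).choose_spec
      (Or.inr ENNReal.coe_ne_top)
    have h2 := (h (a • φ)).choose_spec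
    have h3 : sliceAverage μ V v (a • φ) = fun δ => a * sliceAverage μ V v φ δ := by
      funext δ
      simp only [sliceAverage_eq]
      rw [mul_left_comm, ← lintegral_const_mul (a : ℝ≥0∞) (by have := φ.continuous; fun_prop)]
      simp only [CompactlySupportedContinuousMap.coe_smul, Pi.smul_apply, smul_eq_mul,
        ENNReal.coe_mul]
    have h4 := tendsto_nhds_unique (h2.congr fun δ => congrFun h3 δ) h1
    simp only [smul_eq_mul, RingHom.id_apply]
    exact_mod_cast h4

open Classical in
/-- The sliced measure `μ_{V^⊥+v}`: the Radon measure that represents the functional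
`φ ↦ lim_{δ → 0} (2δ)^{-m} (P_V)_# μ_φ (B(v, δ))` on the continuous functions `φ ≥ 0` with compact
support. At the points `v` where it is not defined, the value is `0`. -/
def slice (μ : Measure (R2n n)) (V : IsoGrass n m) (v : R2n n) : Measure (R2n n) :=
  if h : HasSlice μ V v then NNRealRMK.rieszMeasure (sliceFunctional h) else 0

/-- The defining property of the sliced measures. -/
theorem tendsto_sliceAverage {μ : Measure (R2n n)} {V : IsoGrass n m} {v : R2n n}
    (h : HasSlice μ V v) (φ : CompactlySupportedContinuousMap (R2n n) ℝ≥0) :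
    Tendsto (sliceAverage μ V v φ) (𝓝[>] 0) (𝓝 (∫⁻ x, φ x ∂slice μ V v)) := by
  rw [slice, dif_pos h, NNRealRMK.lintegral_rieszMeasure]
  exact (h φ).choose_spec

end IsoGrass

/-- The `t`-energy `I_t(ν) = ∬ |x - y|^{-t} dν(y) dν(x) ∈ [0, ∞]`. -/
def rieszEnergy {X : Type*} [PseudoEMetricSpace X] [MeasurableSpace X] (t : ℝ) (ν : Measure X) :
    ℝ≥0∞ :=
  ∫⁻ x, ∫⁻ y, edist x y ^ (-t) ∂ν ∂ν

end

/-!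
The energy of a slice is the limit of the energies of the tubes around the fibre, and the tubes
can be averaged over all fibres and all planes with Tonelli's theorem.

Fix a plane `V`. By the Besicovitch differentiation theorem the averages over the tubes
`{x : |P_V x - v| ≤ δ}` converge at almost every `v ∈ V` for one test function `φ`, hence for a
countable family that is uniformly dense on the support of `μ`, hence for all `φ`
(`IsoGrass.ae_hasSlice`). At such a `v` the normalized restrictions `ν_δ` of `μ` to the tubes
converge weakly to the slice `ν`, so that `ν_δ × ν_δ` converges weakly to `ν × ν`. The kernel
`|x - y|^{-t}` is continuous with values in `[0, ∞]`; truncating it at the integers gives the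
formula `I_t(ν) = sup_N lim_j ∬ min(|x - y|^{-t}, N) dν_{δ_j} dν_{δ_j}` along `δ_j = 1 / (j + 1)`
(`IsoGrass.rieszEnergy_slice_eq`). The right-hand side, `IsoGrass.limitEnergy`, is jointly
measurable in `(V, v)` on the whole of `G_h(2n, m) × ℝ^{2n}`, which settles the measurability of
`v ↦ I_t(μ_{V^⊥+v})`. For the measurability in `V`, the integral over `V = g V₀` is transported to
the fixed plane `V₀`; the resulting function of `g ∈ U(n)` is Borel, and a function on the compact
image of `g ↦ g V₀` with Borel pull-back to the Polish group `U(n)` is Borel.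

For the inequality, take `t = s - m`. Fatou's lemma, in `v` and then in `V`, reduces it to a bound,
uniform in `δ`, of the integral over `V` and `v` of `∬ |x - y|^{m-s} dν_δ dν_δ`. Two points `x`, `y`
lie in a common tube of `V` only if `|P_V(x - y)| ≤ 2δ`, and then the set of admissible `v` has
measure at most a constant times `δ^m`. The integral is therefore at most a constant times
`δ^{-m} ∬ μ_{2n,m}{V : |P_V(x - y)| ≤ 2δ} |x - y|^{m-s} dμ dμ`, and the theorem follows from the
transversality estimate `μ_{2n,m}{V : |P_V x| ≤ δ} ≤ c (δ / |x|)^m`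
(`IsoGrass.exists_unif_norm_proj_le`). Since `U(n)` is transitive on spheres, the left-hand side of
that estimate depends only on `|x|` and decreases with it; its value at a unit vector is thus at
most its mean over the unit ball, which by Tonelli's theorem is the proportion of the unit ball on
which `|P_{V₀} x| ≤ δ`, and this set is contained in a box with `m` of its sides equal to `2δ`.
-/

noncomputable section

/-! ### Transitivity of the unitary group on spheres -/

/-- Every vector is the image under `U(n)` of a multiple of a coordinate vector: normalize it and
extend it to an orthonormal basis of `ℂⁿ`. -/
theorem exists_unAct_single {n : ℕ} (i₀ : Fin n) (x : R2n n) :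
    ∃ g : Un n, unAct n g (EuclideanSpace.single (Sum.inl i₀) ‖x‖) = x := by
  rcases eq_or_ne x 0 with rfl | hx
  · exact ⟨1, by simp⟩
  have hx' : ‖x‖ ≠ 0 := norm_ne_zero_iff.2 hx
  let z : EuclideanSpace ℂ (Fin n) :=
    WithLp.toLp 2 fun i => (⟨x (Sum.inl i), x (Sum.inr i)⟩ : ℂ)
  have hz : ‖z‖ = ‖x‖ := by
    rw [EuclideanSpace.norm_eq, EuclideanSpace.norm_eq]
    congr 1
    rw [Fintype.sum_sum_type, ← Finset.sum_add_distrib]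
    refine Finset.sum_congr rfl fun i _ => ?_
    simp only [z, Complex.sq_norm, Complex.normSq_mk, Real.norm_eq_abs, sq_abs]
    ring
  have hu : ‖((‖x‖⁻¹ : ℝ) : ℂ) • z‖ = 1 := by
    rw [norm_smul, hz, Complex.norm_real, norm_inv, norm_norm, inv_mul_cancel₀ hx']
  have hv : Orthonormal ℂ (({i₀} : Set (Fin n)).domRestrict
      fun _ => ((‖x‖⁻¹ : ℝ) : ℂ) • z) := by
    refine ⟨fun _ => hu, fun i j hij => (hij (Subsingleton.elim _ _)).elim⟩
  obtain ⟨b, hb⟩ := hv.exists_orthonormalBasis_extension_of_card_eq (by simp)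
  -- The unitary matrix whose columns are the vectors of the basis `b`.
  obtain ⟨A, hA⟩ : ∃ A : Un n, (A : Matrix (Fin n) (Fin n) ℂ) =
      (EuclideanSpace.basisFun (Fin n) ℂ).toBasis.toMatrix b :=
    ⟨⟨_, (EuclideanSpace.basisFun (Fin n) ℂ).toMatrix_orthonormalBasis_mem_unitary b⟩, rfl⟩
  refine ⟨A, ?_⟩
  have key : ∀ i, (⟨unAct n A (EuclideanSpace.single (Sum.inl i₀) ‖x‖) (Sum.inl i),
      unAct n A (EuclideanSpace.single (Sum.inl i₀) ‖x‖) (Sum.inr i)⟩ : ℂ)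
      = ⟨x (Sum.inl i), x (Sum.inr i)⟩ := by
    intro i
    rw [unAct_coord, Finset.sum_eq_single i₀]
    · have h1 : (A : Matrix (Fin n) (Fin n) ℂ) i i₀ =
          ((‖x‖⁻¹ : ℝ) : ℂ) * ⟨x (Sum.inl i), x (Sum.inr i)⟩ := by
        simp [hA, Module.Basis.toMatrix_apply, hb i₀ rfl, z]
      have h2 : (⟨(EuclideanSpace.single (Sum.inl i₀) ‖x‖ : R2n n) (Sum.inl i₀),
          (EuclideanSpace.single (Sum.inl i₀) ‖x‖ : R2n n) (Sum.inr i₀)⟩ : ℂ) = (‖x‖ : ℂ) := by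
        apply Complex.ext <;> simp
      rw [h1, h2, mul_right_comm, ← Complex.ofReal_mul, inv_mul_cancel₀ hx']
      simp
    · intro j _ hj
      have : (⟨(EuclideanSpace.single (Sum.inl i₀) ‖x‖ : R2n n) (Sum.inl j),
          (EuclideanSpace.single (Sum.inl i₀) ‖x‖ : R2n n) (Sum.inr j)⟩ : ℂ) = 0 := by
        apply Complex.ext <;> simp [hj]
      rw [this, mul_zero]
    · simp
  ext (i | i)
  · exact congrArg Complex.re (key i)
  · exact congrArg Complex.im (key i)

/-- `U(n)` acts transitively on the spheres of `ℝ^{2n}`. -/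
theorem exists_unAct_eq {n : ℕ} {x y : R2n n} (h : ‖x‖ = ‖y‖) : ∃ g : Un n, unAct n g x = y := by
  rcases n.eq_zero_or_pos with rfl | hn
  · exact ⟨1, Subsingleton.elim _ _⟩
  obtain ⟨g, hg⟩ := exists_unAct_single ⟨0, hn⟩ x
  obtain ⟨k, hk⟩ := exists_unAct_single ⟨0, hn⟩ y
  refine ⟨k * g⁻¹, ?_⟩
  rw [← h] at hk
  rw [map_mul, map_inv, ← hk]
  conv_lhs => rw [← hg]
  exact congrArg (unAct n k) ((unAct n g).symm_apply_apply _)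

/-! ### The transversality estimate -/

namespace IsoGrass

variable {n m : ℕ}

theorem proj_act_apply (g : Un n) (V : IsoGrass n m) (x : R2n n) :
    (act g V).proj (unAct n g x) = unAct n g (V.proj x) := by
  have h := Submodule.starProjection_map_apply (unAct n g) V.plane (unAct n g x)
  rwa [LinearIsometryEquiv.symm_apply_apply] at h

theorem norm_proj_act (g : Un n) (V : IsoGrass n m) (x : R2n n) :
    ‖(act g V).proj (unAct n g x)‖ = ‖V.proj x‖ := by
  rw [proj_act_apply, LinearIsometryEquiv.norm_map]

instance : SecondCountableTopology (R2n n →L[ℝ] R2n n) := by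
  have : ProperSpace (R2n n →L[ℝ] R2n n) := FiniteDimensional.proper ℝ _
  infer_instance

instance : SecondCountableTopology (IsoGrass n m) :=
  TopologicalSpace.secondCountableTopology_induced _ _ _

theorem continuous_proj_apply : Continuous fun q : IsoGrass n m × R2n n => q.1.proj q.2 :=
  (continuous_proj.comp continuous_fst).clm_apply continuous_snd

theorem measurableSet_norm_proj_le (x : R2n n) (δ : ℝ) :
    MeasurableSet {V : IsoGrass n m | ‖V.proj x‖ ≤ δ} :=
  (isClosed_le (continuous_proj.clm_apply continuous_const).norm continuous_const).measurableSet

/-- By invariance and transitivity, `μ_{2n,m}{V : |P_V x| ≤ δ}` depends only on `|x|`. -/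
theorem unif_norm_proj_le_congr (h : m ≤ n) {x y : R2n n} (hxy : ‖x‖ = ‖y‖) (δ : ℝ) :
    unif h {V | ‖V.proj x‖ ≤ δ} = unif h {V | ‖V.proj y‖ ≤ δ} := by
  obtain ⟨g, rfl⟩ := exists_unAct_eq hxy
  have hg : Measurable (act g : IsoGrass n m → _) :=
    (continuous_act.comp (Continuous.prodMk_right g)).measurable
  conv_rhs => rw [← map_act_unif h g, Measure.map_apply hg (measurableSet_norm_proj_le _ _)]
  simp only [Set.preimage_ofPred_eq, norm_proj_act]

theorem abs_apply_le_norm_proj_base (h : m ≤ n) (x : R2n n) (i : Fin m) :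
    |x (Sum.inl (Fin.castLE h i))| ≤ ‖(base h).proj x‖ := by
  have hmem : (EuclideanSpace.single (Sum.inl (Fin.castLE h i)) (1 : ℝ) : R2n n) ∈
      (base h).plane := Submodule.subset_span ⟨i, rfl⟩
  have h1 : inner ℝ (EuclideanSpace.single (Sum.inl (Fin.castLE h i)) (1 : ℝ) : R2n n)
      ((base h).proj x) = x (Sum.inl (Fin.castLE h i)) := by
    unfold proj
    rw [← Submodule.inner_starProjection_left_eq_right,
      Submodule.starProjection_eq_self_iff.2 hmem, EuclideanSpace.inner_single_left]
    simp
  rw [← h1, ← Real.norm_eq_abs]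
  refine (norm_inner_le_norm _ _).trans (by simp)

theorem volume_norm_proj_base_le (h : m ≤ n) (δ : ℝ) :
    volume {x : R2n n | x ∈ closedBall 0 1 ∧ ‖(base h).proj x‖ ≤ δ} ≤
      2 ^ (2 * n) * ENNReal.ofReal δ ^ m := by
  -- The set lies in the box with half side `δ` in the directions that span the plane and `1` in
  -- the others.
  let b : Fin n ⊕ Fin n → ℝ := Sum.elim (fun i => if (i : ℕ) < m then δ else 1) fun _ => 1
  have hsub : {x : R2n n | x ∈ closedBall 0 1 ∧ ‖(base h).proj x‖ ≤ δ} ⊆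
      (WithLp.ofLp : R2n n → _) ⁻¹' Set.univ.pi fun i => Set.Icc (-b i) (b i) := by
    rintro x ⟨hx, hxδ⟩ i -
    have hx1 : ∀ i, |x i| ≤ 1 := fun i =>
      (PiLp.norm_apply_le x i).trans (mem_closedBall_zero_iff.1 hx)
    refine abs_le.1 (?_ : |x i| ≤ b i)
    rcases i with i | i
    · by_cases hi : (i : ℕ) < m
      · simpa [b, hi] using! (abs_apply_le_norm_proj_base h x ⟨i, hi⟩).trans hxδ
      · simpa [b, hi] using hx1 _
    · simpa [b] using hx1 _
  refine (measure_mono hsub).trans ?_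
  rw [(PiLp.volume_preserving_ofLp _).measure_preimage
    (MeasurableSet.univ_pi fun _ => measurableSet_Icc).nullMeasurableSet]
  rw [volume_pi_pi, Fintype.prod_sum_type]
  have h1 : ∀ c : ℝ, volume (Set.Icc (-c) c) = 2 * ENNReal.ofReal c := fun c => by
    rw [Real.volume_Icc, sub_neg_eq_add, ← two_mul, ENNReal.ofReal_mul (by norm_num)]; simp
  simp only [h1, b, Sum.elim_inl, Sum.elim_inr, Finset.prod_mul_distrib, Finset.prod_const,
    apply_ite ENNReal.ofReal, ENNReal.ofReal_one, Finset.prod_ite, one_pow, mul_one,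
    Finset.card_univ, Fintype.card_fin]
  rw [show (Finset.univ.filter fun i : Fin n => (i : ℕ) < m).card = m by
    simp [Fin.card_filter_val_lt, h]]
  apply le_of_eq
  ring

theorem volume_norm_proj_act_base_le (h : m ≤ n) (g : Un n) (δ : ℝ) :
    volume {x : R2n n | x ∈ closedBall 0 1 ∧ ‖(act g (base h)).proj x‖ ≤ δ} ≤
      2 ^ (2 * n) * ENNReal.ofReal δ ^ m := by
  refine le_trans (le_of_eq ?_) (volume_norm_proj_base_le h δ)
  have hm : MeasurableSet {x : R2n n | x ∈ closedBall 0 1 ∧ ‖(act g (base h)).proj x‖ ≤ δ} :=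
    isClosed_closedBall.measurableSet.inter
      (isClosed_le (ContinuousLinearMap.continuous _).norm continuous_const).measurableSet
  rw [← (unAct n g).measurePreserving.measure_preimage hm.nullMeasurableSet]
  congr 1
  ext x
  simp [norm_proj_act]

/-- The transversality estimate for unit vectors: the mean over the unit ball of
`x ↦ μ_{2n,m}{V : |P_V x| ≤ δ}` dominates the value on the unit sphere. -/
theorem unif_norm_proj_le_of_norm_eq_one (h : m ≤ n) {x : R2n n} (hx : ‖x‖ = 1) (δ : ℝ) :
    unif h {V | ‖V.proj x‖ ≤ δ} ≤
      (volume (closedBall (0 : R2n n) 1))⁻¹ * 2 ^ (2 * n) * ENNReal.ofReal δ ^ m := by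
  rcases lt_or_ge δ 0 with hδ | hδ
  · have : {V : IsoGrass n m | ‖V.proj x‖ ≤ δ} = ∅ :=
      Set.eq_empty_of_forall_notMem fun V hV => (hδ.trans_le (norm_nonneg _)).not_ge hV
    simp [this]
  have hle : ∀ y ∈ closedBall (0 : R2n n) 1,
      unif h {V | ‖V.proj x‖ ≤ δ} ≤ unif h {V | ‖V.proj y‖ ≤ δ} := by
    intro y hy
    rw [mem_closedBall_zero_iff] at hy
    have : ‖‖y‖ • x‖ = ‖y‖ := by rw [norm_smul, hx, norm_norm, mul_one]
    rw [← unif_norm_proj_le_congr h this]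
    refine measure_mono fun V (hV : _ ≤ δ) => ?_
    rw [Set.mem_ofPred_eq, map_smul, norm_smul, norm_norm]
    exact (mul_le_of_le_one_left (norm_nonneg _) hy).trans hV
  have hcl : MeasurableSet {q : IsoGrass n m × R2n n | ‖q.1.proj q.2‖ ≤ δ} :=
    (isClosed_le continuous_proj_apply.norm continuous_const).measurableSet
  have hball : volume (closedBall (0 : R2n n) 1) ≠ 0 :=
    (measure_closedBall_pos _ _ one_pos).ne'
  have hball' : volume (closedBall (0 : R2n n) 1) ≠ ∞ := measure_closedBall_lt_top.ne
  have key : unif h {V | ‖V.proj x‖ ≤ δ} * volume (closedBall (0 : R2n n) 1) ≤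
      2 ^ (2 * n) * ENNReal.ofReal δ ^ m := by
    calc unif h {V | ‖V.proj x‖ ≤ δ} * volume (closedBall (0 : R2n n) 1)
        = ∫⁻ y in closedBall (0 : R2n n) 1, unif h {V | ‖V.proj x‖ ≤ δ} := by
          rw [setLIntegral_const]
      _ ≤ ∫⁻ y in closedBall (0 : R2n n) 1, unif h {V | ‖V.proj y‖ ≤ δ} :=
          setLIntegral_mono' isClosed_closedBall.measurableSet hle
      _ = ∫⁻ y in closedBall (0 : R2n n) 1, unif h
            ((fun V : IsoGrass n m => (V, y)) ⁻¹' {q | ‖q.1.proj q.2‖ ≤ δ}) := rfl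
      _ = ∫⁻ V, volume.restrict (closedBall (0 : R2n n) 1)
            (Prod.mk V ⁻¹' {q | ‖q.1.proj q.2‖ ≤ δ}) ∂unif h := by
          rw [← Measure.prod_apply_symm hcl, Measure.prod_apply hcl]
      _ ≤ ∫⁻ _, 2 ^ (2 * n) * ENNReal.ofReal δ ^ m ∂unif h := by
          unfold unif
          rw [lintegral_map (measurable_measure_prodMk_left hcl) (measurable_orbit _),
            lintegral_map measurable_const (measurable_orbit _)]
          refine lintegral_mono fun g => ?_
          refine le_trans (le_of_eq ?_) (volume_norm_proj_act_base_le h g δ)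
          rw [Measure.restrict_apply (measurable_prodMk_left hcl), Set.inter_comm]
          rfl
      _ = 2 ^ (2 * n) * ENNReal.ofReal δ ^ m := by simp
  rw [mul_assoc, mul_comm _ (2 ^ (2 * n) * _), ← div_eq_mul_inv]
  exact (ENNReal.le_div_iff_mul_le (Or.inl hball) (Or.inl hball')).2 key

/-- The transversality estimate: planes nearly orthogonal to a given vector are rare. -/
theorem exists_unif_norm_proj_le (h : m ≤ n) : ∃ c : ℝ≥0, ∀ (x : R2n n) (δ : ℝ), x ≠ 0 →
    unif h {V | ‖V.proj x‖ ≤ δ} ≤ c * ENNReal.ofReal (δ / ‖x‖) ^ m := by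
  have hball : volume (closedBall (0 : R2n n) 1) ≠ 0 :=
    (measure_closedBall_pos _ _ one_pos).ne'
  have hc : (volume (closedBall (0 : R2n n) 1))⁻¹ * 2 ^ (2 * n) ≠ ∞ :=
    ENNReal.mul_ne_top (ENNReal.inv_ne_top.2 hball) (by finiteness)
  refine ⟨((volume (closedBall (0 : R2n n) 1))⁻¹ * 2 ^ (2 * n)).toNNReal, fun x δ hx => ?_⟩
  rw [ENNReal.coe_toNNReal hc]
  have hx' : 0 < ‖x‖ := norm_pos_iff.2 hx
  have h1 : ‖‖x‖⁻¹ • x‖ = 1 := by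
    rw [norm_smul, norm_inv, norm_norm, inv_mul_cancel₀ hx'.ne']
  refine le_trans (measure_mono fun V (hV : _ ≤ δ) => ?_)
    (unif_norm_proj_le_of_norm_eq_one h h1 (δ / ‖x‖))
  rw [Set.mem_ofPred_eq, map_smul, norm_smul, norm_inv, norm_norm, div_eq_inv_mul]
  gcongr

end IsoGrass

/-! ### Test functions and vague convergence -/

section Approximation

variable {X : Type*} [MetricSpace X] [ProperSpace X]

/-- Urysohn's lemma, with a compactly supported `ℝ≥0`-valued function. -/
theorem exists_compactlySupported_one_zero {K t : Set X} (hK : IsCompact K) (ht : IsClosed t)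
    (hd : Disjoint K t) : ∃ χ : CompactlySupportedContinuousMap X ℝ≥0,
      (∀ x ∈ K, χ x = 1) ∧ ∀ x ∈ t, χ x = 0 := by
  obtain ⟨f, h1, h0, hf, -⟩ := exists_continuous_one_zero_of_isCompact hK ht hd
  refine ⟨⟨⟨fun x => (f x).toNNReal, by fun_prop⟩, hf.comp_left Real.toNNReal_zero⟩,
    fun x hx => ?_, fun x hx => ?_⟩
  · change (f x).toNNReal = 1
    simp [h1 hx]
  · change (f x).toNNReal = 0
    simp [h0 hx]

/-- Countably many compactly supported functions approximate all of them uniformly on a compact set,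
because `C(K, ℝ≥0)` is second countable. -/
theorem exists_countable_compactlySupported_dense {K : Set X} (hK : IsCompact K) :
    ∃ D : Set (CompactlySupportedContinuousMap X ℝ≥0), D.Countable ∧
      ∀ φ : CompactlySupportedContinuousMap X ℝ≥0, ∀ ε : ℝ≥0, 0 < ε → ∃ ψ ∈ D, ∀ x ∈ K,
        φ x ≤ ψ x + ε ∧ ψ x ≤ φ x + ε := by
  have : CompactSpace K := isCompact_iff_compactSpace.1 hK
  let R : CompactlySupportedContinuousMap X ℝ≥0 → C(K, ℝ≥0) := fun φ =>
    φ.toContinuousMap.restrict K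
  obtain ⟨S, hS, hd⟩ := TopologicalSpace.exists_countable_dense (Set.range R)
  refine ⟨(fun z : Set.range R => z.2.choose) '' S, hS.image _, fun φ ε hε => ?_⟩
  obtain ⟨z, hz, hzφ⟩ := hd.exists_dist_lt ⟨R φ, φ, rfl⟩ (NNReal.coe_pos.2 hε)
  refine ⟨_, ⟨z, hz, rfl⟩, fun x hx => ?_⟩
  have h1 : dist (φ x) (z.2.choose x) < ε := by
    have h2 : (z : C(K, ℝ≥0)) ⟨x, hx⟩ = z.2.choose x := by
      conv_lhs => rw [← z.2.choose_spec]
      rfl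
    rw [← h2]
    exact (ContinuousMap.dist_apply_le_dist (f := R φ) (g := z) ⟨x, hx⟩).trans_lt hzφ
  rw [NNReal.dist_eq, abs_lt] at h1
  constructor
  · exact_mod_cast (by linarith : (φ x : ℝ) ≤ z.2.choose x + ε)
  · exact_mod_cast (by linarith : (z.2.choose x : ℝ) ≤ φ x + ε)

end Approximation

/-- A Cauchy criterion in `[0, ∞]`. -/
theorem exists_tendsto_of_forall_approx {ι : Type*} {l : Filter ι} [l.NeBot] {f : ι → ℝ≥0∞}
    (h : ∀ ε : ℝ≥0, 0 < ε → ∃ L : ℝ≥0, ∀ᶠ i in l, f i ≤ L + ε ∧ (L : ℝ≥0∞) ≤ f i + ε) :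
    ∃ L : ℝ≥0, Tendsto f l (𝓝 L) := by
  have hsup : limsup f l ≤ liminf f l := by
    refine ENNReal.le_of_forall_pos_le_add fun ε hε _ => ?_
    obtain ⟨L, hL⟩ := h (ε / 2) (half_pos hε)
    have h1 : limsup f l ≤ L + (ε / 2 : ℝ≥0) :=
      limsup_le_of_le (by isBoundedDefault) (hL.mono fun i hi => hi.1)
    have h2 : (L : ℝ≥0∞) - (ε / 2 : ℝ≥0) ≤ liminf f l :=
      le_liminf_of_le (by isBoundedDefault) (hL.mono fun i hi => tsub_le_iff_right.2 hi.2)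
    calc limsup f l ≤ L + (ε / 2 : ℝ≥0) := h1
      _ ≤ (liminf f l + (ε / 2 : ℝ≥0)) + (ε / 2 : ℝ≥0) := by
        gcongr; exact tsub_le_iff_right.1 h2
      _ = liminf f l + ε := by
        rw [add_assoc, ← ENNReal.coe_add, add_halves]
  have hfin : limsup f l ≠ ∞ := by
    obtain ⟨L, hL⟩ := h 1 one_pos
    exact ne_top_of_le_ne_top (by finiteness)
      (limsup_le_of_le (a := (L : ℝ≥0∞) + (1 : ℝ≥0)) (by isBoundedDefault)
        (hL.mono fun i hi => hi.1))
  refine ⟨(limsup f l).toNNReal, ?_⟩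
  rw [ENNReal.coe_toNNReal hfin]
  exact tendsto_of_le_liminf_of_limsup_le hsup le_rfl

/-- For measures concentrated on `K`, convergence of the integrals of a family of test functions
that is uniformly dense on `K` implies convergence for all test functions. The function `χ` controls
the total masses. -/
theorem exists_tendsto_lintegral_of_dense {X ι : Type*} [TopologicalSpace X]
    [MeasurableSpace X] [BorelSpace X] {l : Filter ι} [l.NeBot] {ν : ι → Measure X} {K : Set X}
    (hνK : ∀ i, ν i Kᶜ = 0)
    {D : Set (CompactlySupportedContinuousMap X ℝ≥0)}
    (hD : ∀ φ : CompactlySupportedContinuousMap X ℝ≥0, ∀ ε : ℝ≥0, 0 < ε → ∃ ψ ∈ D, ∀ x ∈ K,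
        φ x ≤ ψ x + ε ∧ ψ x ≤ φ x + ε)
    {χ : CompactlySupportedContinuousMap X ℝ≥0} (hχ : ∀ x ∈ K, χ x = 1)
    (hDlim : ∀ ψ ∈ insert χ D, ∃ L : ℝ≥0, Tendsto (fun i => ∫⁻ x, ψ x ∂ν i) l (𝓝 L))
    (φ : CompactlySupportedContinuousMap X ℝ≥0) :
    ∃ L : ℝ≥0, Tendsto (fun i => ∫⁻ x, φ x ∂ν i) l (𝓝 L) := by
  refine exists_tendsto_of_forall_approx fun ε hε => ?_
  obtain ⟨M, hM⟩ := hDlim χ (Set.mem_insert _ _)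
  let η : ℝ≥0 := ε / 2 / (M + 1)
  have hη : 0 < η := by positivity
  obtain ⟨ψ, hψD, hψ⟩ := hD φ η hη
  obtain ⟨L, hL⟩ := hDlim ψ (Set.mem_insert_of_mem _ hψD)
  have hε2 : 0 < (((ε / 2 : ℝ≥0)) : ℝ≥0∞) := by exact_mod_cast half_pos hε
  have e1 : ∀ᶠ i in l, ∫⁻ x, χ x ∂ν i ≤ M + 1 :=
    (hM.eventually_lt_const (ENNReal.lt_add_right ENNReal.coe_ne_top one_ne_zero)).mono
      fun i hi => hi.le
  have e2 : ∀ᶠ i in l, ∫⁻ x, ψ x ∂ν i ≤ L + (ε / 2 : ℝ≥0) :=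
    (hL.eventually_lt_const (ENNReal.lt_add_right ENNReal.coe_ne_top hε2.ne')).mono
      fun i hi => hi.le
  have e3 : ∀ᶠ i in l, (L : ℝ≥0∞) ≤ ∫⁻ x, ψ x ∂ν i + (ε / 2 : ℝ≥0) := by
    have h1 : Tendsto (fun i => ∫⁻ x, ψ x ∂ν i + (ε / 2 : ℝ≥0)) l (𝓝 (L + (ε / 2 : ℝ≥0))) :=
      hL.add tendsto_const_nhds
    exact (h1.eventually_const_lt (ENNReal.lt_add_right ENNReal.coe_ne_top hε2.ne')).mono
      fun i hi => hi.le
  have hcomp : ∀ i, ∀ φ₁ φ₂ : CompactlySupportedContinuousMap X ℝ≥0,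
      (∀ x ∈ K, φ₁ x ≤ φ₂ x + η) →
        ∫⁻ x, φ₁ x ∂ν i ≤ ∫⁻ x, φ₂ x ∂ν i + η * ∫⁻ x, χ x ∂ν i := by
    intro i φ₁ φ₂ hle
    have hm₂ := φ₂.continuous
    have hmχ := χ.continuous
    rw [← lintegral_const_mul _ (by fun_prop), ← lintegral_add_left (by fun_prop)]
    refine lintegral_mono_ae ?_
    filter_upwards [compl_mem_ae_iff.2 (hνK i)] with x hx
    rw [hχ x (not_not.1 hx)]
    simpa using ENNReal.coe_le_coe.2 (hle x (not_not.1 hx))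
  have hηM : (η : ℝ≥0∞) * (M + 1) = (ε / 2 : ℝ≥0) := by
    have : η * (M + 1) = ε / 2 := div_mul_cancel₀ _ (by positivity)
    exact_mod_cast this
  have hsum : ((ε / 2 : ℝ≥0) : ℝ≥0∞) + (ε / 2 : ℝ≥0) = ε := by
    rw [← ENNReal.coe_add, add_halves]
  refine ⟨L, ?_⟩
  filter_upwards [e1, e2, e3] with i h1 h2 h3
  constructor
  · calc ∫⁻ x, φ x ∂ν i ≤ ∫⁻ x, ψ x ∂ν i + η * ∫⁻ x, χ x ∂ν i :=
          hcomp i φ ψ fun x hx => (hψ x hx).1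
      _ ≤ (L + (ε / 2 : ℝ≥0)) + η * (M + 1) := by gcongr
      _ = L + ε := by rw [hηM, add_assoc, hsum]
  · calc (L : ℝ≥0∞) ≤ ∫⁻ x, ψ x ∂ν i + (ε / 2 : ℝ≥0) := h3
      _ ≤ (∫⁻ x, φ x ∂ν i + η * ∫⁻ x, χ x ∂ν i) + (ε / 2 : ℝ≥0) := by
          gcongr; exact hcomp i ψ φ fun x hx => (hψ x hx).2
      _ ≤ (∫⁻ x, φ x ∂ν i + η * (M + 1)) + (ε / 2 : ℝ≥0) := by gcongr
      _ = ∫⁻ x, φ x ∂ν i + ε := by rw [hηM, add_assoc, hsum]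

/-! ### Weak convergence of squares of measures -/

section WeakConvergence

variable {X ι : Type*} [MetricSpace X] [ProperSpace X] [MeasurableSpace X] [BorelSpace X]

theorem lintegral_prod_self_eq_mass_mul [Nonempty X] (ν : FiniteMeasure X) (f : X × X → ℝ≥0∞) :
    ∫⁻ z, f z ∂((ν : Measure X).prod (ν : Measure X)) =
      ν.mass * (ν.mass *
        ∫⁻ z, f z ∂(ν.normalize.prod ν.normalize : ProbabilityMeasure (X × X))) := by
  have h : (ν : Measure X) = (ν.mass : ℝ≥0∞) • (ν.normalize : Measure X) := by
    conv_lhs => rw [ν.self_eq_mass_smul_normalize]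
    rfl
  rw [ProbabilityMeasure.toMeasure_prod]
  conv_lhs => rw [h]
  rw [Measure.prod_smul_left, Measure.prod_smul_right, lintegral_smul_measure,
    lintegral_smul_measure]
  rfl

/-- If finite measures converge weakly, so do their squares. The statement is reduced to the one for
probability measures by normalization, which requires a nonzero limit. -/
theorem FiniteMeasure.tendsto_lintegral_prod_self {l : Filter ι} {ν : ι → FiniteMeasure X}
    {ν' : FiniteMeasure X} (h : Tendsto ν l (𝓝 ν')) (f : BoundedContinuousFunction (X × X) ℝ≥0) :
    Tendsto (fun i => ∫⁻ z, f z ∂((ν i : Measure X).prod (ν i : Measure X))) l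
      (𝓝 (∫⁻ z, f z ∂((ν' : Measure X).prod (ν' : Measure X)))) := by
  rcases isEmpty_or_nonempty X with hX | hX
  · simpa [lintegral_of_isEmpty] using! tendsto_const_nhds
  by_cases h0 : ν' = 0
  · have h1 : Tendsto (fun i => (ν i).prod (ν i)) l (𝓝 (ν'.prod ν')) := by
      rw [h0, FiniteMeasure.zero_prod]
      refine FiniteMeasure.tendsto_zero_of_tendsto_zero_mass ?_
      simpa [FiniteMeasure.mass_prod, h0] using h.mass.mul h.mass
    exact FiniteMeasure.tendsto_iff_forall_lintegral_tendsto.1 h1 f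
  · have h1 := FiniteMeasure.tendsto_normalize_of_tendsto h h0
    have h2 : Tendsto (fun i => (ν i).normalize.prod (ν i).normalize) l
        (𝓝 (ν'.normalize.prod ν'.normalize)) :=
      (ProbabilityMeasure.continuous_prod.tendsto (ν'.normalize, ν'.normalize)).comp
        (h1.prodMk_nhds h1)
    have h3 := ProbabilityMeasure.tendsto_iff_forall_lintegral_tendsto.1 h2 f
    have h4 : Tendsto (fun i => ((ν i).mass : ℝ≥0∞)) l (𝓝 ν'.mass) :=
      ENNReal.tendsto_coe.2 h.mass
    have h5 : ∫⁻ z, f z ∂(ν'.normalize.prod ν'.normalize : ProbabilityMeasure (X × X)) ≠ ∞ :=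
      (BoundedContinuousFunction.lintegral_lt_top_of_nnreal _ f).ne
    simp only [lintegral_prod_self_eq_mass_mul]
    exact ENNReal.Tendsto.mul h4 (Or.inr (by finiteness)) 
      (ENNReal.Tendsto.mul h4 (Or.inr h5) h3 (Or.inr (by finiteness))) (Or.inr (by finiteness))

variable {l : Filter ι} {ν : ι → Measure X} {ν' : Measure X} {K : Set X}

/-- A vague limit of measures concentrated on a compact set is concentrated on it. -/
theorem measure_compl_eq_zero_of_tendsto [l.NeBot] [ν'.Regular] (hK : IsCompact K)
    (hνK : ∀ i, ν i Kᶜ = 0)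
    (h : ∀ φ : CompactlySupportedContinuousMap X ℝ≥0,
      Tendsto (fun i => ∫⁻ x, φ x ∂ν i) l (𝓝 (∫⁻ x, φ x ∂ν'))) : ν' Kᶜ = 0 := by
  rw [hK.isClosed.isOpen_compl.measure_eq_iSup_isCompact]
  simp only [ENNReal.iSup_eq_zero]
  intro C hCK hC
  obtain ⟨χ, h1, h0⟩ := exists_compactlySupported_one_zero hC hK.isClosed
    (Set.disjoint_left.2 fun x hx => hCK hx)
  have h2 : ∀ i, ∫⁻ x, χ x ∂ν i = 0 := by
    intro i
    refine lintegral_eq_zero_of_ae_eq_zero ?_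
    filter_upwards [compl_mem_ae_iff.2 (hνK i)] with x hx
    simp [h0 x (not_not.1 hx)]
  have h3 : ∫⁻ x, χ x ∂ν' = 0 := by
    have := h χ
    simp only [h2] at this
    exact tendsto_nhds_unique this tendsto_const_nhds
  refine le_antisymm ?_ zero_le
  calc ν' C = ∫⁻ x in C, χ x ∂ν' := by
        rw [setLIntegral_congr_fun hC.measurableSet (fun x hx => by rw [h1 x hx])]; simp
    _ ≤ ∫⁻ x, χ x ∂ν' := setLIntegral_le_lintegral _ _
    _ = 0 := h3

/-- On a common compact set, vague convergence implies weak convergence, also of the squares. -/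
theorem lintegral_prod_min_tendsto [l.NeBot] [∀ i, IsFiniteMeasure (ν i)] [ν'.Regular]
    (hK : IsCompact K) (hνK : ∀ i, ν i Kᶜ = 0)
    (h : ∀ φ : CompactlySupportedContinuousMap X ℝ≥0,
      Tendsto (fun i => ∫⁻ x, φ x ∂ν i) l (𝓝 (∫⁻ x, φ x ∂ν')))
    {k : X × X → ℝ≥0∞} (hk : Continuous k) (N : ℝ≥0) :
    Tendsto (fun i => ∫⁻ x, ∫⁻ y, min (k (x, y)) N ∂ν i ∂ν i) l
      (𝓝 (∫⁻ x, ∫⁻ y, min (k (x, y)) N ∂ν' ∂ν')) := by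
  have h0 := measure_compl_eq_zero_of_tendsto hK hνK h
  have hfin : IsFiniteMeasure ν' := by
    refine ⟨?_⟩
    rw [← measure_add_measure_compl hK.measurableSet, h0, add_zero]
    exact hK.measure_lt_top
  obtain ⟨χ, h1, -⟩ := exists_compactlySupported_one_zero hK isClosed_empty
    (Set.disjoint_empty K)
  let ρ : ι → FiniteMeasure X := fun i => ⟨ν i, inferInstance⟩
  let ρ' : FiniteMeasure X := ⟨ν', hfin⟩
  have hw : Tendsto ρ l (𝓝 ρ') := by
    rw [FiniteMeasure.tendsto_iff_forall_lintegral_tendsto]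
    intro f
    let φ : CompactlySupportedContinuousMap X ℝ≥0 :=
      ⟨⟨fun x => f x * χ x, by have := χ.continuous; fun_prop⟩, χ.hasCompactSupport.mul_left⟩
    have h2 : ∀ τ : Measure X, τ Kᶜ = 0 → ∫⁻ x, f x ∂τ = ∫⁻ x, φ x ∂τ := by
      intro τ hτ
      refine lintegral_congr_ae ?_
      filter_upwards [compl_mem_ae_iff.2 hτ] with x hx
      have : φ x = f x * χ x := rfl
      rw [this, h1 x (not_not.1 hx), mul_one]
    have h3 := h φ
    rw [← h2 ν' h0] at h3
    exact h3.congr fun i => (h2 _ (hνK i)).symm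
  have hc : Continuous fun z : X × X => (min (k z) N).toNNReal := by
    refine continuous_iff_continuousAt.2 fun z => ?_
    exact (ENNReal.tendsto_toNNReal (by simp)).comp
      ((hk.min continuous_const).tendsto z)
  let f : BoundedContinuousFunction (X × X) ℝ≥0 :=
    BoundedContinuousFunction.mkOfBound ⟨_, hc⟩ N (by
      have hN : ∀ z, (min (k z) (N : ℝ≥0∞)).toNNReal ≤ N := fun z =>
        ENNReal.toNNReal_mono ENNReal.coe_ne_top (min_le_right _ _)
      intro x y
      rw [NNReal.dist_eq, abs_le]
      have hx : ((min (k x) (N : ℝ≥0∞)).toNNReal : ℝ) ≤ N := hN x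
      have hy : ((min (k y) (N : ℝ≥0∞)).toNNReal : ℝ) ≤ N := hN y
      have hx' := (min (k x) (N : ℝ≥0∞)).toNNReal.coe_nonneg
      have hy' := (min (k y) (N : ℝ≥0∞)).toNNReal.coe_nonneg
      constructor <;> simp only [ContinuousMap.coe_mk] <;> linarith)
  have hf : ∀ z, (f z : ℝ≥0∞) = min (k z) N := fun z =>
    ENNReal.coe_toNNReal (by simp)
  have h4 := FiniteMeasure.tendsto_lintegral_prod_self hw f
  simp only [hf] at h4
  change Tendsto (fun i => ∫⁻ z, min (k z) N ∂((ν i).prod (ν i))) l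
    (𝓝 (∫⁻ z, min (k z) N ∂(ν'.prod ν'))) at h4
  have hm : Measurable fun z : X × X => min (k z) (N : ℝ≥0∞) :=
    (hk.min continuous_const).measurable
  rw [lintegral_prod _ hm.aemeasurable] at h4
  refine h4.congr fun i => ?_
  rw [lintegral_prod _ hm.aemeasurable]

theorem lintegral_eq_iSup_min {Y : Type*} [MeasurableSpace Y] (τ : Measure Y) {f : Y → ℝ≥0∞}
    (hf : Measurable f) : ∫⁻ y, f y ∂τ = ⨆ N : ℕ, ∫⁻ y, min (f y) N ∂τ := by
  rw [← lintegral_iSup (fun N => hf.min measurable_const)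
    (fun N M h y => min_le_min le_rfl (by exact_mod_cast h))]
  refine lintegral_congr fun y => ?_
  rw [← inf_iSup_eq, ENNReal.iSup_natCast]
  simp

/-- The energy of a vague limit, for a continuous kernel with values in `[0, ∞]`. The truncation is
needed, as the energies of the measures themselves need not converge. -/
theorem lintegral_lintegral_eq_iSup_liminf [l.NeBot] [∀ i, IsFiniteMeasure (ν i)] [ν'.Regular]
    [SFinite ν'] (hK : IsCompact K) (hνK : ∀ i, ν i Kᶜ = 0)
    (h : ∀ φ : CompactlySupportedContinuousMap X ℝ≥0,
      Tendsto (fun i => ∫⁻ x, φ x ∂ν i) l (𝓝 (∫⁻ x, φ x ∂ν')))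
    {k : X × X → ℝ≥0∞} (hk : Continuous k) :
    ∫⁻ x, ∫⁻ y, k (x, y) ∂ν' ∂ν' =
      ⨆ N : ℕ, liminf (fun i => ∫⁻ x, ∫⁻ y, min (k (x, y)) N ∂ν i ∂ν i) l := by
  rw [lintegral_lintegral (f := fun x y => k (x, y)) hk.measurable.aemeasurable,
    lintegral_eq_iSup_min _ (f := fun z : X × X => k (z.1, z.2)) hk.measurable]
  refine iSup_congr fun N => ?_
  rw [← lintegral_lintegral (f := fun x y => min (k (x, y)) N)
    (hk.min continuous_const).measurable.aemeasurable]
  exact_mod_cast (lintegral_prod_min_tendsto hK hνK h hk N).liminf_eq.symm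

end WeakConvergence

/-! ### Hausdorff measure on a plane -/

/-- The `μH[m]`-measure of the unit ball of `ℝ^m`. The Hausdorff measure of Mathlib is not
normalized to agree with Lebesgue measure, so this is not the usual volume. -/
def hausdorffUnitBall (m : ℕ) : ℝ≥0∞ :=
  (μH[m] : Measure (EuclideanSpace ℝ (Fin m))) (ball 0 1)

instance isAddHaarMeasure_hausdorffMeasure_euclideanSpace (m : ℕ) :
    (μH[m] : Measure (EuclideanSpace ℝ (Fin m))).IsAddHaarMeasure := by
  have h := isAddHaarMeasure_hausdorffMeasure (E := EuclideanSpace ℝ (Fin m))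
  rwa [finrank_euclideanSpace_fin] at h

theorem hausdorffUnitBall_ne_zero (m : ℕ) : hausdorffUnitBall m ≠ 0 :=
  (measure_ball_pos _ _ one_pos).ne'

theorem hausdorffUnitBall_ne_top (m : ℕ) : hausdorffUnitBall m ≠ ∞ :=
  measure_ball_lt_top.ne

namespace IsoGrass

variable {n m : ℕ}

/-- The `m`-dimensional Hausdorff measure on the plane `V`, as a measure on `ℝ^{2n}`. -/
def planeMeasure (V : IsoGrass n m) : Measure (R2n n) :=
  (μH[m] : Measure (R2n n)).restrict (V.plane : Set (R2n n))

theorem exists_isometry_range_eq (V : IsoGrass n m) :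
    ∃ j : EuclideanSpace ℝ (Fin m) →ₗᵢ[ℝ] R2n n, Set.range j = V.plane := by
  let b := (stdOrthonormalBasis ℝ V.plane).reindex (finCongr V.finrank_eq)
  refine ⟨V.plane.subtypeₗᵢ.comp b.repr.symm.toLinearIsometry, ?_⟩
  ext x
  constructor
  · rintro ⟨y, rfl⟩
    exact (b.repr.symm y).2
  · intro hx
    exact ⟨b.repr ⟨x, hx⟩, by simp⟩

theorem map_eq_planeMeasure (V : IsoGrass n m) {j : EuclideanSpace ℝ (Fin m) →ₗᵢ[ℝ] R2n n}
    (hj : Set.range j = V.plane) : (μH[m]).map j = V.planeMeasure := by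
  rw [planeMeasure, ← hj]
  exact j.isometry.map_hausdorffMeasure (Or.inl m.cast_nonneg)

theorem ae_mem_plane (V : IsoGrass n m) : ∀ᵐ v ∂V.planeMeasure, v ∈ V.plane :=
  ae_restrict_mem V.plane.closed_of_finiteDimensional.measurableSet

theorem planeMeasure_closedBall (V : IsoGrass n m) {v : R2n n} (hv : v ∈ V.plane) {r : ℝ}
    (hr : 0 ≤ r) :
    V.planeMeasure (closedBall v r) = ENNReal.ofReal r ^ m * hausdorffUnitBall m := by
  obtain ⟨j, hj⟩ := V.exists_isometry_range_eq
  obtain ⟨w, rfl⟩ : v ∈ Set.range j := by rw [hj]; exact hv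
  rw [← V.map_eq_planeMeasure hj, Measure.map_apply j.continuous.measurable
    isClosed_closedBall.measurableSet, j.isometry.preimage_closedBall,
    Measure.addHaar_closedBall _ _ hr, finrank_euclideanSpace_fin, ENNReal.ofReal_pow hr]
  rfl

instance (V : IsoGrass n m) : IsFiniteMeasureOnCompacts V.planeMeasure := by
  obtain ⟨j, hj⟩ := V.exists_isometry_range_eq
  refine ⟨fun K hK => ?_⟩
  rw [← V.map_eq_planeMeasure hj, Measure.map_apply j.continuous.measurable hK.measurableSet]
  exact (j.isometry.isClosedEmbedding.isCompact_preimage hK).measure_lt_top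

theorem map_act_planeMeasure (g : Un n) (V : IsoGrass n m) :
    V.planeMeasure.map (unAct n g) = (act g V).planeMeasure := by
  obtain ⟨j, hj⟩ := V.exists_isometry_range_eq
  have h : Set.range ((unAct n g).toLinearIsometry.comp j) = (act g V).plane := by
    rw [LinearIsometry.coe_comp, Set.range_comp, hj]
    rfl
  rw [← V.map_eq_planeMeasure hj, ← (act g V).map_eq_planeMeasure h,
    Measure.map_map (unAct n g).continuous.measurable j.continuous.measurable]
  rfl

/-! ### Existence of the sliced measures -/

/-- The measure `(2δ)^{-m} μ` restricted to the tube `{x : |P_V x - v| ≤ δ}`. -/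
def tubeMeasure (μ : Measure (R2n n)) (V : IsoGrass n m) (v : R2n n) (δ : ℝ) : Measure (R2n n) :=
  (ENNReal.ofReal (2 * δ) ^ m)⁻¹ • μ.restrict (V.proj ⁻¹' closedBall v δ)

theorem sliceAverage_eq_lintegral_tubeMeasure (μ : Measure (R2n n)) (V : IsoGrass n m)
    (v : R2n n) (φ : CompactlySupportedContinuousMap (R2n n) ℝ≥0) (δ : ℝ) :
    sliceAverage μ V v φ δ = ∫⁻ x, φ x ∂tubeMeasure μ V v δ := by
  rw [sliceAverage_eq, tubeMeasure, lintegral_smul_measure, smul_eq_mul]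

theorem tubeMeasure_compl_eq_zero {μ : Measure (R2n n)} {K : Set (R2n n)} (hK : μ Kᶜ = 0)
    (V : IsoGrass n m) (v : R2n n) (δ : ℝ) : tubeMeasure μ V v δ Kᶜ = 0 := by
  have : μ.restrict (V.proj ⁻¹' closedBall v δ) Kᶜ = 0 :=
    Measure.absolutelyContinuous_of_le Measure.restrict_le_self hK
  simp [tubeMeasure, this]

theorem isFiniteMeasure_tubeMeasure (μ : Measure (R2n n)) [IsFiniteMeasure μ] (V : IsoGrass n m)
    (v : R2n n) {δ : ℝ} (hδ : 0 < δ) : IsFiniteMeasure (tubeMeasure μ V v δ) := by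
  refine Measure.smul_finite _ (ENNReal.inv_ne_top.2 (pow_ne_zero _ ?_))
  simpa using hδ

/-- Differentiation of the image under `P_V` of `φ μ` with respect to `μH[m]` on `V`. -/
theorem ae_exists_tendsto_sliceAverage (μ : Measure (R2n n)) [IsFiniteMeasure μ]
    (V : IsoGrass n m) (φ : CompactlySupportedContinuousMap (R2n n) ℝ≥0) :
    ∀ᵐ v ∂V.planeMeasure, ∃ L : ℝ≥0, Tendsto (sliceAverage μ V v φ) (𝓝[>] 0) (𝓝 (L : ℝ≥0∞)) := by
  set ρ : Measure (R2n n) := (μ.withDensity fun x => (φ x : ℝ≥0∞)).map V.proj with hρ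
  have hfin : IsFiniteMeasure (μ.withDensity fun x => (φ x : ℝ≥0∞)) :=
    isFiniteMeasure_withDensity (BoundedContinuousFunction.lintegral_lt_top_of_nnreal μ
      (φ : BoundedContinuousFunction (R2n n) ℝ≥0)).ne
  have hρfin : IsFiniteMeasure ρ := Measure.isFiniteMeasure_map _ _
  filter_upwards [Besicovitch.ae_tendsto_rnDeriv ρ V.planeMeasure,
    Measure.rnDeriv_lt_top ρ V.planeMeasure, V.ae_mem_plane] with v h1 h2 hv
  have hc : hausdorffUnitBall m / 2 ^ m ≠ ∞ := by
    exact ENNReal.div_ne_top (hausdorffUnitBall_ne_top m) (by simp)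
  refine ⟨(ρ.rnDeriv V.planeMeasure v * (hausdorffUnitBall m / 2 ^ m)).toNNReal, ?_⟩
  rw [ENNReal.coe_toNNReal (ENNReal.mul_ne_top h2.ne hc)]
  refine (ENNReal.Tendsto.mul_const h1 (Or.inr hc)).congr' ?_
  filter_upwards [self_mem_nhdsWithin] with r (hr : 0 < r)
  have hr1 : ENNReal.ofReal r ^ m ≠ 0 := pow_ne_zero _ (by simpa using hr)
  have hr2 : ENNReal.ofReal r ^ m ≠ ∞ := by finiteness
  rw [V.planeMeasure_closedBall hv hr.le, sliceAverage, ← hρ, ENNReal.ofReal_mul (by norm_num),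
    mul_pow, ENNReal.ofReal_ofNat, ENNReal.mul_inv (Or.inr hr2) (Or.inr hr1), div_eq_mul_inv,
    div_eq_mul_inv, ENNReal.mul_inv (Or.inl hr1) (Or.inl hr2)]
  have h3 := ENNReal.inv_mul_cancel (hausdorffUnitBall_ne_zero m) (hausdorffUnitBall_ne_top m)
  calc ρ (closedBall v r) * ((ENNReal.ofReal r ^ m)⁻¹ * (hausdorffUnitBall m)⁻¹) *
        (hausdorffUnitBall m * (2 ^ m)⁻¹)
      = ((hausdorffUnitBall m)⁻¹ * hausdorffUnitBall m) *
        ((2 ^ m)⁻¹ * (ENNReal.ofReal r ^ m)⁻¹ * ρ (closedBall v r)) := by ring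
    _ = _ := by rw [h3, one_mul]

theorem ae_hasSlice (μ : Measure (R2n n)) [IsFiniteMeasure μ] {K : Set (R2n n)}
    (hK : IsCompact K) (hμK : μ Kᶜ = 0) (V : IsoGrass n m) :
    ∀ᵐ v ∂V.planeMeasure, HasSlice μ V v := by
  obtain ⟨D, hDc, hD⟩ := exists_countable_compactlySupported_dense hK
  obtain ⟨χ, hχ, -⟩ := exists_compactlySupported_one_zero hK isClosed_empty
    (Set.disjoint_empty K)
  have h := (ae_ball_iff (hDc.insert χ)).2 fun φ _ => ae_exists_tendsto_sliceAverage μ V φ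
  filter_upwards [h] with v hv φ
  simp only [funext (sliceAverage_eq_lintegral_tubeMeasure μ V v _)] at hv ⊢
  exact exists_tendsto_lintegral_of_dense (tubeMeasure_compl_eq_zero hμK V v) hD hχ hv φ

/-! ### The energy of a slice as a limit -/

/-- The double integral of `f` with respect to the normalized restriction of `μ` to the tube
`{x : |P_V x - v| ≤ δ}`. -/
def tubeEnergy (f : R2n n × R2n n → ℝ≥0∞) (μ : Measure (R2n n)) (V : IsoGrass n m) (v : R2n n)
    (δ : ℝ) : ℝ≥0∞ :=
  ∫⁻ x, ∫⁻ y, f (x, y) ∂tubeMeasure μ V v δ ∂tubeMeasure μ V v δ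

instance (μ : Measure (R2n n)) (V : IsoGrass n m) (v : R2n n) : (slice μ V v).Regular := by
  rw [slice]
  split_ifs with h
  · exact NNRealRMK.rieszMeasure_regular _
  · infer_instance

theorem tendsto_one_div_add_atTop_nhdsGT :
    Tendsto (fun j : ℕ => 1 / ((j : ℝ) + 1)) atTop (𝓝[>] 0) :=
  tendsto_nhdsWithin_iff.2 ⟨tendsto_one_div_add_atTop_nhds_zero_nat,
    Eventually.of_forall fun j => Set.mem_Ioi.2 (by positivity)⟩

/-- The limit of the truncated `t`-energies of the tubes around the fibre `V^⊥ + v`, along the radii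
`1 / (j + 1)`. With a `liminf` in place of the limit it is defined, and Borel, at all `(V, v)`. -/
def limitEnergy (t : ℝ) (μ : Measure (R2n n)) (V : IsoGrass n m) (v : R2n n) : ℝ≥0∞ :=
  ⨆ N : ℕ, liminf (fun j : ℕ =>
    tubeEnergy (fun z => min (edist z.1 z.2 ^ (-t)) N) μ V v (1 / ((j : ℝ) + 1))) atTop

theorem continuous_edist_rpow (t : ℝ) : Continuous fun z : R2n n × R2n n =>
    edist z.1 z.2 ^ (-t) :=
  ENNReal.continuous_rpow_const.comp continuous_edist

theorem rieszEnergy_slice_eq {μ : Measure (R2n n)} [IsFiniteMeasure μ] {K : Set (R2n n)}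
    (hK : IsCompact K) (hμK : μ Kᶜ = 0) (t : ℝ) {V : IsoGrass n m} {v : R2n n}
    (h : HasSlice μ V v) : rieszEnergy t (slice μ V v) = limitEnergy t μ V v := by
  have : ∀ j : ℕ, IsFiniteMeasure (tubeMeasure μ V v (1 / ((j : ℝ) + 1))) := fun j =>
    isFiniteMeasure_tubeMeasure μ V v (by positivity)
  refine lintegral_lintegral_eq_iSup_liminf
    (ν := fun j : ℕ => tubeMeasure μ V v (1 / ((j : ℝ) + 1)))
    (l := atTop) hK (fun j => tubeMeasure_compl_eq_zero hμK V v _) (fun φ => ?_)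
    (continuous_edist_rpow t)
  simp only [← sliceAverage_eq_lintegral_tubeMeasure]
  exact (tendsto_sliceAverage h φ).comp tendsto_one_div_add_atTop_nhdsGT

theorem ae_rieszEnergy_slice_eq {μ : Measure (R2n n)} [IsFiniteMeasure μ] {K : Set (R2n n)}
    (hK : IsCompact K) (hμK : μ Kᶜ = 0) (t : ℝ) (V : IsoGrass n m) :
    ∀ᵐ v ∂V.planeMeasure, rieszEnergy t (slice μ V v) = limitEnergy t μ V v :=
  (ae_hasSlice μ hK hμK V).mono fun _ h => rieszEnergy_slice_eq hK hμK t h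

/-! ### Measurability -/

/-- The indicator function at `x` of the tube `{x : |P_V x - v| ≤ δ}`, where `q = (V, v)`. -/
def tubeIndicator (δ : ℝ) (q : IsoGrass n m × R2n n) (x : R2n n) : ℝ≥0∞ :=
  (closedBall q.2 δ).indicator 1 (q.1.proj x)

theorem measurable_tubeIndicator (δ : ℝ) : Measurable fun p : (IsoGrass n m × R2n n) × R2n n =>
    tubeIndicator δ p.1 p.2 := by
  have h1 : MeasurableSet {p : (IsoGrass n m × R2n n) × R2n n |
      dist (p.1.1.proj p.2) p.1.2 ≤ δ} :=
    (isClosed_le ((continuous_proj_apply.comp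
      ((continuous_fst.comp continuous_fst).prodMk continuous_snd)).dist
      (continuous_snd.comp continuous_fst)) continuous_const).measurableSet
  exact (measurable_const (a := (1 : ℝ≥0∞))).indicator h1

theorem measurable_tubeIndicator_apply (δ : ℝ) (q : IsoGrass n m × R2n n) :
    Measurable (tubeIndicator δ q) :=
  (measurable_one.indicator isClosed_closedBall.measurableSet).comp q.1.proj.continuous.measurable

theorem lintegral_tubeMeasure (μ : Measure (R2n n)) (V : IsoGrass n m) (v : R2n n) (δ : ℝ)
    (g : R2n n → ℝ≥0∞) : ∫⁻ x, g x ∂tubeMeasure μ V v δ =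
      (ENNReal.ofReal (2 * δ) ^ m)⁻¹ * ∫⁻ x, tubeIndicator δ (V, v) x * g x ∂μ := by
  have hS : MeasurableSet (V.proj ⁻¹' closedBall v δ) :=
    V.proj.continuous.measurable isClosed_closedBall.measurableSet
  rw [tubeMeasure, lintegral_smul_measure, smul_eq_mul, ← lintegral_indicator hS]
  congr 1
  refine lintegral_congr fun x => ?_
  by_cases hx : V.proj x ∈ closedBall v δ
  · simp [tubeIndicator, hx]
  · simp [tubeIndicator, hx]

theorem tubeEnergy_eq {f : R2n n × R2n n → ℝ≥0∞} (hf : Measurable f) (μ : Measure (R2n n))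
    [SFinite μ] (V : IsoGrass n m) (v : R2n n) (δ : ℝ) :
    tubeEnergy f μ V v δ = (ENNReal.ofReal (2 * δ) ^ m)⁻¹ * (ENNReal.ofReal (2 * δ) ^ m)⁻¹ *
      ∫⁻ x, ∫⁻ y, tubeIndicator δ (V, v) x * tubeIndicator δ (V, v) y * f (x, y) ∂μ ∂μ := by
  have hm := measurable_tubeIndicator_apply δ (V, v)
  have hm1 : ∀ x, Measurable fun y => tubeIndicator δ (V, v) y * f (x, y) := fun x =>
    hm.mul (hf.comp measurable_prodMk_left)
  have hm2 : Measurable fun x => ∫⁻ y, tubeIndicator δ (V, v) y * f (x, y) ∂μ :=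
    Measurable.lintegral_prod_right' (f := fun z : R2n n × R2n n =>
      tubeIndicator δ (V, v) z.2 * f z) ((hm.comp measurable_snd).mul hf)
  simp only [tubeEnergy, lintegral_tubeMeasure, mul_assoc]
  congr 1
  rw [← lintegral_const_mul _ (by simpa only [lintegral_const_mul _ (hm1 _)] using! hm.mul hm2)]
  refine lintegral_congr fun x => ?_
  rw [lintegral_const_mul _ (hm1 x), mul_left_comm]

theorem measurable_tubeEnergy {f : R2n n × R2n n → ℝ≥0∞} (hf : Measurable f)
    (μ : Measure (R2n n)) [SFinite μ] (δ : ℝ) :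
    Measurable fun q : IsoGrass n m × R2n n => tubeEnergy f μ q.1 q.2 δ := by
  simp only [tubeEnergy_eq hf]
  refine Measurable.const_mul ?_ _
  refine Measurable.lintegral_prod_right' (f := fun p : (IsoGrass n m × R2n n) × R2n n =>
    ∫⁻ y, tubeIndicator δ p.1 p.2 * tubeIndicator δ p.1 y * f (p.2, y) ∂μ) ?_
  refine Measurable.lintegral_prod_right'
    (f := fun p : ((IsoGrass n m × R2n n) × R2n n) × R2n n =>
    tubeIndicator δ p.1.1 p.1.2 * tubeIndicator δ p.1.1 p.2 * f (p.1.2, p.2)) ?_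
  have h := measurable_tubeIndicator (n := n) (m := m) δ
  exact ((h.comp measurable_fst).mul
    (h.comp ((measurable_fst.comp measurable_fst).prodMk measurable_snd))).mul
    (hf.comp ((measurable_snd.comp measurable_fst).prodMk measurable_snd))

theorem measurable_tubeEnergy_left {f : R2n n × R2n n → ℝ≥0∞} (hf : Measurable f)
    (μ : Measure (R2n n)) [SFinite μ] (V : IsoGrass n m) (δ : ℝ) :
    Measurable fun v => tubeEnergy f μ V v δ := by
  have h := (measurable_tubeEnergy (m := m) hf μ δ).comp (measurable_prodMk_left (x := V))
  exact h

theorem measurable_limitEnergy (t : ℝ) (μ : Measure (R2n n)) [SFinite μ] :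
    Measurable fun q : IsoGrass n m × R2n n => limitEnergy t μ q.1 q.2 :=
  Measurable.iSup fun _ => Measurable.liminf fun _ => measurable_tubeEnergy
    ((continuous_edist_rpow t).min continuous_const).measurable μ _

theorem aemeasurable_rieszEnergy_slice {μ : Measure (R2n n)} [IsFiniteMeasure μ] {K : Set (R2n n)}
    (hK : IsCompact K) (hμK : μ Kᶜ = 0) (t : ℝ) (V : IsoGrass n m) :
    AEMeasurable (fun v => rieszEnergy t (slice μ V v)) V.planeMeasure :=
  ((measurable_limitEnergy t μ).comp measurable_prodMk_left).aemeasurable.congr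
    ((ae_rieszEnergy_slice_eq hK hμK t V).mono fun _ h => h.symm)

instance : PolishSpace (Un n) := by
  have : PolishSpace (Matrix (Fin n) (Fin n) ℂ) :=
    inferInstanceAs (PolishSpace (Fin n → Fin n → ℂ))
  exact (isClosed_unitary (R := Matrix (Fin n) (Fin n) ℂ)).polishSpace

theorem proj_injective : Function.Injective (proj : IsoGrass n m → _) := fun V W h => by
  ext1
  have h1 := congrArg (fun T : R2n n →L[ℝ] R2n n => LinearMap.range (T : R2n n →ₗ[ℝ] R2n n)) h
  simpa [proj, Submodule.range_starProjection] using h1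

instance : T2Space (IsoGrass n m) :=
  T2Space.of_injective_continuous proj_injective continuous_proj

/-- Measurability on the Grassmannian can be tested on `U(n)`: the orbit of `V₀` is a compact set of
full measure, and a function on the image of a Polish space under a Borel map is Borel if its
pull-back is. -/
theorem aemeasurable_of_measurable_comp_act (h : m ≤ n) {f : IsoGrass n m → ℝ≥0∞}
    (hf : Measurable fun g : Un n => f (act g (base h))) : AEMeasurable f (unif h) := by
  have hπ := measurable_orbit (base h)
  have hS : MeasurableSet (Set.range fun g : Un n => act g (base h)) :=
    (isCompact_range (continuous_act.comp (Continuous.prodMk_left _))).measurableSet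
  have h1 : ∀ᵐ V ∂unif h, V ∈ Set.range fun g : Un n => act g (base h) := by
    refine (ae_map_iff hπ.aemeasurable hS).2 ?_
    exact Eventually.of_forall fun g => ⟨g, rfl⟩
  have h2 := (hπ.measurable_comp_iff_restrict (g := f)).1 hf
  rw [← Measure.restrict_eq_self_of_ae_mem h1]
  exact (aemeasurable_restrict_iff_comap_subtype hS).2 h2.aemeasurable

/-- The integral over `g V₀` is transported to the fixed plane `V₀`. -/
theorem aemeasurable_lintegral_planeMeasure (h : m ≤ n) {F : IsoGrass n m × R2n n → ℝ≥0∞}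
    (hF : Measurable F) :
    AEMeasurable (fun V : IsoGrass n m => ∫⁻ v, F (V, v) ∂V.planeMeasure) (unif h) := by
  refine aemeasurable_of_measurable_comp_act h ?_
  have h1 : ∀ g : Un n, ∫⁻ v, F (act g (base h), v) ∂(act g (base h)).planeMeasure =
      ∫⁻ v, F (act g (base h), unAct n g v) ∂(base h).planeMeasure := by
    intro g
    rw [← map_act_planeMeasure]
    exact lintegral_map (f := fun v => F (act g (base h), v)) (hF.comp measurable_prodMk_left)
      (unAct n g).continuous.measurable
  simp only [h1]
  have hc : Continuous fun p : Un n × R2n n => unAct n p.1 p.2 :=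
    (continuous_toCLM_realMatrix.comp (continuous_subtype_val.comp continuous_fst)).clm_apply
      continuous_snd
  exact Measurable.lintegral_prod_right' (f := fun p : Un n × R2n n =>
    F (act p.1 (base h), unAct n p.1 p.2))
    (hF.comp (((measurable_orbit (base h)).comp measurable_fst).prodMk hc.measurable))

/-! ### Averaging over the fibres and the planes -/

/-- The indicator function of `|P_V(x - y)| ≤ δ`, where `z = (x, y)`. -/
def closeIndicator (δ : ℝ) (V : IsoGrass n m) (z : R2n n × R2n n) : ℝ≥0∞ :=
  {V : IsoGrass n m | ‖V.proj (z.1 - z.2)‖ ≤ δ}.indicator 1 V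

theorem measurable_closeIndicator (δ : ℝ) :
    Measurable fun p : IsoGrass n m × (R2n n × R2n n) =>
      closeIndicator δ p.1 p.2 := by
  have h : MeasurableSet {p : IsoGrass n m × (R2n n × R2n n) |
      ‖p.1.proj (p.2.1 - p.2.2)‖ ≤ δ} :=
    (isClosed_le (continuous_proj_apply.comp
      (continuous_fst.prodMk ((continuous_fst.comp continuous_snd).sub
        (continuous_snd.comp continuous_snd)))).norm continuous_const).measurableSet
  exact (measurable_const (a := (1 : ℝ≥0∞))).indicator h

theorem tubeIndicator_eq_indicator_closedBall (δ : ℝ) (V : IsoGrass n m) (v x : R2n n) :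
    tubeIndicator δ (V, v) x = (closedBall (V.proj x) δ).indicator 1 v := by
  by_cases h : V.proj x ∈ closedBall v δ
  · rw [tubeIndicator, Set.indicator_of_mem h, Set.indicator_of_mem (mem_closedBall_comm.1 h)]
    rfl
  · rw [tubeIndicator, Set.indicator_of_notMem h,
      Set.indicator_of_notMem fun h' => h (mem_closedBall_comm.1 h')]

theorem measurable_tubeIndicator_left (δ : ℝ) (V : IsoGrass n m) (x : R2n n) :
    Measurable fun v => tubeIndicator δ (V, v) x := by
  simp only [tubeIndicator_eq_indicator_closedBall]
  exact measurable_one.indicator isClosed_closedBall.measurableSet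

theorem lintegral_tubeIndicator_mul_le (V : IsoGrass n m) {δ : ℝ} (hδ : 0 ≤ δ) (x y : R2n n) :
    ∫⁻ v, tubeIndicator δ (V, v) x * tubeIndicator δ (V, v) y ∂V.planeMeasure ≤
      ENNReal.ofReal δ ^ m * hausdorffUnitBall m *
        closeIndicator (2 * δ) V (x, y) := by
  simp only [tubeIndicator_eq_indicator_closedBall]
  by_cases h : ‖V.proj (x - y)‖ ≤ 2 * δ
  · have hV : V ∈ {V : IsoGrass n m | ‖V.proj ((x, y).1 - (x, y).2)‖ ≤ 2 * δ} := h
    rw [closeIndicator, Set.indicator_of_mem hV,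
      Pi.one_apply, mul_one,
      ← V.planeMeasure_closedBall (Submodule.starProjection_apply_mem V.plane x) hδ,
      ← lintegral_indicator_one isClosed_closedBall.measurableSet]
    refine lintegral_mono fun v => mul_le_of_le_one_right zero_le ?_
    exact Set.indicator_le_self' (fun _ _ => zero_le) v
  · refine le_of_eq_of_le ?_ zero_le
    rw [lintegral_eq_zero_iff' (by
      exact ((measurable_one.indicator isClosed_closedBall.measurableSet).mul
        (measurable_one.indicator isClosed_closedBall.measurableSet)).aemeasurable)]
    refine Eventually.of_forall fun v => ?_
    by_contra h0
    obtain ⟨hx, hy⟩ := mul_ne_zero_iff.1 h0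
    have hx' := Set.mem_of_indicator_ne_zero hx
    have hy' := Set.mem_of_indicator_ne_zero hy
    refine h ?_
    rw [map_sub, ← dist_eq_norm]
    calc dist (V.proj x) (V.proj y) ≤ dist (V.proj x) v + dist v (V.proj y) := dist_triangle _ _ _
      _ ≤ δ + δ := add_le_add (mem_closedBall'.1 hx') (mem_closedBall.1 hy')
      _ = 2 * δ := by ring

/-- The energies of the tubes, integrated over the base points in a fixed plane: two points share a
tube of radius `δ` only if their projections have distance at most `2δ`. -/
theorem lintegral_tubeEnergy_le {f : R2n n × R2n n → ℝ≥0∞} (hf : Measurable f)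
    (μ : Measure (R2n n)) [SFinite μ] (V : IsoGrass n m) {δ : ℝ} (hδ : 0 < δ) :
    ∫⁻ v, tubeEnergy f μ V v δ ∂V.planeMeasure ≤
      hausdorffUnitBall m * (ENNReal.ofReal (2 * δ) ^ m)⁻¹ *
        ∫⁻ z, closeIndicator (2 * δ) V z * f z
          ∂μ.prod μ := by
  set D := ENNReal.ofReal (2 * δ) ^ m with hD
  have hD0 : D ≠ 0 := pow_ne_zero _ (by simpa using hδ)
  have hDt : D ≠ ∞ := by finiteness
  have hm := measurable_tubeIndicator (n := n) (m := m) δ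
  have hG : Measurable fun p : R2n n × (R2n n × R2n n) =>
      tubeIndicator δ (V, p.1) p.2.1 * tubeIndicator δ (V, p.1) p.2.2 * f p.2 := by
    have hV : Measurable fun p : R2n n × (R2n n × R2n n) => (V, p.1) :=
      measurable_const.prodMk measurable_fst
    exact ((hm.comp (hV.prodMk (measurable_fst.comp measurable_snd))).mul
      (hm.comp (hV.prodMk (measurable_snd.comp measurable_snd)))).mul (hf.comp measurable_snd)
  have h1 : ∀ v, tubeEnergy f μ V v δ = D⁻¹ * D⁻¹ *
      ∫⁻ z, tubeIndicator δ (V, v) z.1 * tubeIndicator δ (V, v) z.2 * f z ∂μ.prod μ := by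
    intro v
    rw [tubeEnergy_eq hf]
    congr 1
    exact (lintegral_prod (fun z : R2n n × R2n n =>
      tubeIndicator δ (V, v) z.1 * tubeIndicator δ (V, v) z.2 * f z)
      (hG.comp (measurable_prodMk_left (x := v))).aemeasurable).symm
  simp only [h1]
  rw [lintegral_const_mul _ hG.lintegral_prod_right', lintegral_lintegral_swap hG.aemeasurable]
  have h2 : ∀ z : R2n n × R2n n, ∫⁻ v, tubeIndicator δ (V, v) z.1 * tubeIndicator δ (V, v) z.2 * f z
      ∂V.planeMeasure ≤ ENNReal.ofReal δ ^ m * hausdorffUnitBall m *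
        (closeIndicator (2 * δ) V z * f z) := by
    intro z
    have hz : Measurable fun v => tubeIndicator δ (V, v) z.1 * tubeIndicator δ (V, v) z.2 :=
      (measurable_tubeIndicator_left δ V z.1).mul (measurable_tubeIndicator_left δ V z.2)
    rw [lintegral_mul_const _ hz, ← mul_assoc]
    gcongr
    exact lintegral_tubeIndicator_mul_le V hδ.le z.1 z.2
  have h3 : D⁻¹ * D⁻¹ * (ENNReal.ofReal δ ^ m * hausdorffUnitBall m) ≤
      hausdorffUnitBall m * D⁻¹ := by
    calc D⁻¹ * D⁻¹ * (ENNReal.ofReal δ ^ m * hausdorffUnitBall m)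
        ≤ D⁻¹ * D⁻¹ * (D * hausdorffUnitBall m) := by
          gcongr
          rw [hD]
          gcongr
          linarith
      _ = (D⁻¹ * D) * (hausdorffUnitBall m * D⁻¹) := by ring
      _ = hausdorffUnitBall m * D⁻¹ := by rw [ENNReal.inv_mul_cancel hD0 hDt, one_mul]
  have hM : Measurable fun z : R2n n × R2n n =>
      closeIndicator (2 * δ) V z * f z :=
    ((measurable_closeIndicator (2 * δ)).comp (measurable_prodMk_left (x := V))).mul hf
  refine (mul_le_mul_right (lintegral_mono h2) _).trans ?_
  rw [lintegral_const_mul _ hM, ← mul_assoc]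
  gcongr

/-- The transversality estimate in the form in which it is integrated. It includes the diagonal
`x = y`, where the kernel vanishes if `s < m` and the right-hand side is infinite if `s ≥ m`; the
latter is why the constant is `c + 1`, which cannot be zero. -/
theorem inv_mul_unif_mul_edist_rpow_le (h : m ≤ n) (hm : 0 < m) {c : ℝ≥0}
    (hc : ∀ (x : R2n n) (δ : ℝ), x ≠ 0 →
      unif h {V | ‖V.proj x‖ ≤ δ} ≤ c * ENNReal.ofReal (δ / ‖x‖) ^ m)
    (s : ℝ) {δ : ℝ} (hδ : 0 < δ) (x y : R2n n) :
    (ENNReal.ofReal δ ^ m)⁻¹ * (unif h {V | ‖V.proj (x - y)‖ ≤ δ} * edist x y ^ (-(s - m))) ≤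
      (c + 1) * edist x y ^ (-s) := by
  have hD0 : ENNReal.ofReal δ ^ m ≠ 0 := pow_ne_zero _ (by simpa using hδ)
  have hDt : ENNReal.ofReal δ ^ m ≠ ∞ := by finiteness
  have hm' : (0 : ℝ) < m := by exact_mod_cast hm
  rcases eq_or_ne x y with rfl | hxy
  · rcases lt_or_ge s m with hs | hs
    · rw [edist_self, ENNReal.zero_rpow_of_pos (by linarith), mul_zero, mul_zero]
      exact zero_le
    · rw [edist_self x, ENNReal.zero_rpow_of_neg (y := -s) (by linarith),
        ENNReal.mul_top (by simp)]
      exact le_top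
  · have he0 : edist x y ≠ 0 := (edist_pos.2 hxy).ne'
    have het : edist x y ≠ ∞ := edist_ne_top x y
    have hn : 0 < ‖x - y‖ := norm_pos_iff.2 (sub_ne_zero.2 hxy)
    have h1 := hc (x - y) δ (sub_ne_zero.2 hxy)
    rw [ENNReal.ofReal_div_of_pos hn, ← dist_eq_norm, ← edist_dist, div_eq_mul_inv, mul_pow,
      ← ENNReal.inv_pow] at h1
    have h2 : (edist x y ^ m)⁻¹ * edist x y ^ (-(s - m)) = edist x y ^ (-s) := by
      rw [← ENNReal.rpow_natCast, ← ENNReal.rpow_neg, ← ENNReal.rpow_add _ _ he0 het]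
      congr 1
      ring
    calc (ENNReal.ofReal δ ^ m)⁻¹ *
          (unif h {V | ‖V.proj (x - y)‖ ≤ δ} * edist x y ^ (-(s - m)))
        ≤ (ENNReal.ofReal δ ^ m)⁻¹ * ((c * (ENNReal.ofReal δ ^ m * (edist x y ^ m)⁻¹)) *
          edist x y ^ (-(s - m))) := by gcongr
      _ = ((ENNReal.ofReal δ ^ m)⁻¹ * ENNReal.ofReal δ ^ m) *
          (c * ((edist x y ^ m)⁻¹ * edist x y ^ (-(s - m)))) := by ring
      _ = c * edist x y ^ (-s) := by rw [ENNReal.inv_mul_cancel hD0 hDt, one_mul, h2]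
      _ ≤ (c + 1) * edist x y ^ (-s) := by gcongr; exact le_self_add

theorem lintegral_limitEnergy_le_liminf (t : ℝ) (μ : Measure (R2n n)) [SFinite μ]
    (V : IsoGrass n m) :
    ∫⁻ v, limitEnergy t μ V v ∂V.planeMeasure ≤
      liminf (fun j : ℕ => ∫⁻ v, tubeEnergy (fun z => edist z.1 z.2 ^ (-t)) μ V v
        (1 / ((j : ℝ) + 1)) ∂V.planeMeasure) atTop := by
  have hT : ∀ j : ℕ, Measurable fun v =>
      tubeEnergy (fun z => edist z.1 z.2 ^ (-t)) μ V v (1 / ((j : ℝ) + 1)) := fun j =>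
    measurable_tubeEnergy_left (continuous_edist_rpow t).measurable μ V _
  refine (lintegral_mono fun v => iSup_le fun N => liminf_le_liminf ?_).trans
    (lintegral_liminf_le hT)
  exact Eventually.of_forall fun j => lintegral_mono fun x => lintegral_mono fun y =>
    min_le_left _ _

theorem lintegral_closeIndicator_unif (h : m ≤ n) (δ : ℝ) (z : R2n n × R2n n) :
    ∫⁻ V, closeIndicator δ V z ∂unif h = unif h {V | ‖V.proj (z.1 - z.2)‖ ≤ δ} :=
  lintegral_indicator_one (measurableSet_norm_proj_le _ _)

theorem lintegral_lintegral_closeIndicator_le (h : m ≤ n) (hm : 0 < m) {c : ℝ≥0}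
    (hc : ∀ (x : R2n n) (δ : ℝ), x ≠ 0 →
      unif h {V | ‖V.proj x‖ ≤ δ} ≤ c * ENNReal.ofReal (δ / ‖x‖) ^ m)
    (s : ℝ) (μ : Measure (R2n n)) [SFinite μ] {δ : ℝ} (hδ : 0 < δ) :
    (ENNReal.ofReal δ ^ m)⁻¹ * ∫⁻ V, ∫⁻ z, closeIndicator δ V z *
        edist z.1 z.2 ^ (-(s - m)) ∂μ.prod μ ∂unif h ≤ (c + 1) * rieszEnergy s μ := by
  have hk : Measurable fun z : R2n n × R2n n => edist z.1 z.2 ^ (-(s - m)) :=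
    (continuous_edist_rpow _).measurable
  have hI := measurable_closeIndicator (n := n) (m := m) δ
  have hG : Measurable fun p : IsoGrass n m × (R2n n × R2n n) =>
      closeIndicator δ p.1 p.2 * edist p.2.1 p.2.2 ^ (-(s - m)) :=
    hI.mul (hk.comp measurable_snd)
  have hI' : ∀ z : R2n n × R2n n, Measurable fun V : IsoGrass n m => closeIndicator δ V z :=
    fun z => measurable_one.indicator (measurableSet_norm_proj_le _ _)
  have hU : Measurable fun z : R2n n × R2n n =>
      ∫⁻ V : IsoGrass n m, closeIndicator δ V z * edist z.1 z.2 ^ (-(s - m)) ∂unif h :=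
    hG.lintegral_prod_left'
  rw [lintegral_lintegral_swap hG.aemeasurable, ← lintegral_const_mul _ hU]
  calc ∫⁻ z, (ENNReal.ofReal δ ^ m)⁻¹ * ∫⁻ V : IsoGrass n m, closeIndicator δ V z *
          edist z.1 z.2 ^ (-(s - m)) ∂unif h ∂μ.prod μ
      ≤ ∫⁻ z, (c + 1) * edist z.1 z.2 ^ (-s) ∂μ.prod μ := by
        refine lintegral_mono fun z => ?_
        dsimp only
        rw [lintegral_mul_const _ (hI' z), lintegral_closeIndicator_unif]
        exact inv_mul_unif_mul_edist_rpow_le h hm hc s hδ z.1 z.2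
    _ = (c + 1) * rieszEnergy s μ := by
        rw [lintegral_const_mul _ (continuous_edist_rpow s).measurable,
          lintegral_prod _ (continuous_edist_rpow s).measurable.aemeasurable]
        rfl

theorem lintegral_limitEnergy_le (h : m ≤ n) (hm : 0 < m) {c : ℝ≥0}
    (hc : ∀ (x : R2n n) (δ : ℝ), x ≠ 0 →
      unif h {V | ‖V.proj x‖ ≤ δ} ≤ c * ENNReal.ofReal (δ / ‖x‖) ^ m)
    (s : ℝ) (μ : Measure (R2n n)) [SFinite μ] :
    ∫⁻ V, ∫⁻ v, limitEnergy (s - m) μ V v ∂V.planeMeasure ∂unif h ≤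
      hausdorffUnitBall m * (c + 1) * rieszEnergy s μ := by
  have hk : Measurable fun z : R2n n × R2n n => edist z.1 z.2 ^ (-(s - m)) :=
    (continuous_edist_rpow _).measurable
  have hd : ∀ j : ℕ, (0 : ℝ) < 1 / ((j : ℝ) + 1) := fun j => by positivity
  -- An upper bound of the integral over `V` of the energies of the tubes.
  let B : ℕ → IsoGrass n m → ℝ≥0∞ := fun j V =>
    ∫⁻ z, closeIndicator (2 * (1 / ((j : ℝ) + 1))) V z * edist z.1 z.2 ^ (-(s - m)) ∂μ.prod μ
  let a : ℕ → ℝ≥0∞ := fun j => (ENNReal.ofReal (2 * (1 / ((j : ℝ) + 1))) ^ m)⁻¹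
  have hB : ∀ j, Measurable (B j) := fun j =>
    Measurable.lintegral_prod_right' (f := fun p : IsoGrass n m × (R2n n × R2n n) =>
      closeIndicator (2 * (1 / ((j : ℝ) + 1))) p.1 p.2 * edist p.2.1 p.2.2 ^ (-(s - m)))
      ((measurable_closeIndicator _).mul (hk.comp measurable_snd))
  have h1 : ∀ V : IsoGrass n m, ∫⁻ v, limitEnergy (s - m) μ V v ∂V.planeMeasure ≤
      liminf (fun j => hausdorffUnitBall m * a j * B j V) atTop := fun V =>
    (lintegral_limitEnergy_le_liminf (s - m) μ V).trans (liminf_le_liminf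
      (Eventually.of_forall fun j => lintegral_tubeEnergy_le hk μ V (hd j)))
  have h2 : ∀ j, ∫⁻ V, hausdorffUnitBall m * a j * B j V ∂unif h ≤
      hausdorffUnitBall m * (c + 1) * rieszEnergy s μ := by
    intro j
    rw [lintegral_const_mul _ (hB j), mul_assoc, mul_assoc]
    exact mul_le_mul_right
      (lintegral_lintegral_closeIndicator_le h hm hc s μ (mul_pos two_pos (hd j))) _
  calc ∫⁻ V, ∫⁻ v, limitEnergy (s - m) μ V v ∂V.planeMeasure ∂unif h
      ≤ ∫⁻ V, liminf (fun j => hausdorffUnitBall m * a j * B j V) atTop ∂unif h :=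
        lintegral_mono h1
    _ ≤ liminf (fun j => ∫⁻ V, hausdorffUnitBall m * a j * B j V ∂unif h) atTop :=
        lintegral_liminf_le fun j => (hB j).const_mul _
    _ ≤ _ := liminf_le_of_le (by isBoundedDefault) fun b hb => by
        obtain ⟨j, hj⟩ := hb.exists
        exact hj.trans (h2 j)

end IsoGrass

end

theorem lemma10 (n m : ℕ) (hm : 0 < m) (hmn : m ≤ n) :
    ∃ c : ℝ≥0, ∀ (s : ℝ) (μ : Measure (R2n n)) [IsFiniteMeasureOnCompacts μ],
      (∃ K : Set (R2n n), IsCompact K ∧ μ Kᶜ = 0) →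
        (∀ V : IsoGrass n m,
          (∀ᵐ v ∂(μH[m] : Measure (R2n n)).restrict (V.plane : Set (R2n n)),
            IsoGrass.HasSlice μ V v) ∧
          AEMeasurable (fun v => rieszEnergy (s - m) (IsoGrass.slice μ V v))
            ((μH[m] : Measure (R2n n)).restrict (V.plane : Set (R2n n)))) ∧
        AEMeasurable (fun V : IsoGrass n m => ∫⁻ v in (V.plane : Set (R2n n)),
          rieszEnergy (s - m) (IsoGrass.slice μ V v) ∂μH[m]) (IsoGrass.unif hmn) ∧
        ∫⁻ V, ∫⁻ v in (V.plane : Set (R2n n)),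
            rieszEnergy (s - m) (IsoGrass.slice μ V v) ∂μH[m] ∂(IsoGrass.unif hmn) ≤
          c * rieszEnergy s μ := by
  obtain ⟨c, hc⟩ := IsoGrass.exists_unif_norm_proj_le hmn
  refine ⟨(hausdorffUnitBall m).toNNReal * (c + 1), fun s μ _ => ?_⟩
  rintro ⟨K, hK, hμK⟩
  have hfin : IsFiniteMeasure μ := ⟨by
    rw [← measure_add_measure_compl hK.measurableSet, hμK, add_zero]
    exact hK.measure_lt_top⟩
  have hV : ∀ V : IsoGrass n m,
      ∫⁻ v in (V.plane : Set (R2n n)), rieszEnergy (s - m) (IsoGrass.slice μ V v) ∂μH[m] =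
        ∫⁻ v, IsoGrass.limitEnergy (s - m) μ V v ∂V.planeMeasure := fun V =>
    lintegral_congr_ae (IsoGrass.ae_rieszEnergy_slice_eq hK hμK _ V)
  refine ⟨fun V => ⟨IsoGrass.ae_hasSlice μ hK hμK V,
    IsoGrass.aemeasurable_rieszEnergy_slice hK hμK _ V⟩, ?_, ?_⟩
  · simp only [hV]
    exact IsoGrass.aemeasurable_lintegral_planeMeasure hmn
      (IsoGrass.measurable_limitEnergy (s - m) μ)
  · simp only [hV, ENNReal.coe_mul, ENNReal.coe_toNNReal (hausdorffUnitBall_ne_top m),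
      ENNReal.coe_add, ENNReal.coe_one]
    exact IsoGrass.lintegral_limitEnergy_le hmn hm hc s μ
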